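/- Let $(M,g)$ be a smooth Riemannian manifold of dimension $m$ (Hausdorff, without boundary) with Levi-Civita connection $\nabla$, and let $\mathcal D\subseteq TM$ be a regular distribution, i.e. a smooth subbundle of $TM$ of constant rank $n$. Let $\Gamma(\mathcal D)$ be the set of smooth vector fields $X$ on $M$ with $X(p)\in\mathcal D_p$ for all $p\in M$, and let $\pi^{\mathcal D}:TM\to\mathcal D$ be the orthogonal projection. For $X,Y\in\Gamma(\mathcal D)$ put $\nabla^{\mathcal D}_XY=\pi^{\mathcal D}(\nabla_XY)$ (the intrinsic connection), $B(X,Y)=\nabla_XY-\nabla^{\mathcal D}_XY$ (the second fundamental form) and $B^s(X,Y)=\tfrac12\bigl(B(X,Y)+B(Y,X)\bigr)$ (its symmetric part). Let $\gamma:J\to M$ be a smooth curve on an open interval $J\subseteq\mathbb R$. It is a $\nabla$-geodesic if $\nabla_{\dot\gamma}\dot\gamma=0$. It is a $\nabla^{\mathcal D}$-geodesic if $\dot\gamma(t)\in\mathcal D_{\gamma(t)}$ for all $t\in J$ and $\nabla^{\mathcal D}_{\dot\gamma}\dot\gamma=\pi^{\mathcal D}(\nabla_{\dot\gamma}\dot\gamma)=0$.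 The distribution $\mathcal D$ is totally geodesic if for every $\nabla$-geodesic $\gamma:J\to M$ with $\dot\gamma(t_0)\in\mathcal D_{\gamma(t_0)}$ for some $t_0\in J$ one has $\dot\gamma(t)\in\mathcal D_{\gamma(t)}$ for all $t\in J$. Then the following five conditions are equivalent: 1. $\mathcal D$ is totally geodesic. 2. Every $\nabla^{\mathcal D}$-geodesic is a $\nabla$-geodesic. 3. $B^s(X,Y)=0$ for all $X,Y\in\Gamma(\mathcal D)$. 4. $\nabla_XY+\nabla_YX\in\Gamma(\mathcal D)$ for all $X,Y\in\Gamma(\mathcal D)$. 5. $\nabla_XX\in\Gamma(\mathcal D)$ for all $X\in\Gamma(\mathcal D)$. -/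

import Mathlib

noncomputable section

namespace DistGeom

/-- The algebra behind the Koszul formula: the correction term turning a connection with
nonmetricity `T` and torsion `τ` into the Levi-Civita connection. -/
lemma exists_koszul_correction {V : Type*} [NormedAddCommGroup V] [InnerProductSpace ℝ V]
    [FiniteDimensional ℝ V] (T : V →L[ℝ] V →L[ℝ] V →L[ℝ] ℝ) (τ : V →L[ℝ] V →L[ℝ] V)
    (hT : ∀ s t v, T s t v = T t s v) (hτ : ∀ u v, τ u v = - τ v u) :
    ∃ A : V →L[ℝ] V →L[ℝ] V,
      (∀ s t v, inner ℝ (A s v) t + inner ℝ s (A t v) = T s t v) ∧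
      (∀ u v, τ u v + A v u - A u v = 0) := by
  have : CompleteSpace V := FiniteDimensional.complete ℝ V
  let φ : V → V → V →L[ℝ] ℝ := fun s v => LinearMap.toContinuousLinearMap
    { toFun := fun t => T s t v + T v t s - T s v t - inner ℝ (τ v s) t
              + inner ℝ (τ s t) v - inner ℝ (τ t v) s
      map_add' := by
        intro a b
        simp only [map_add, add_apply, inner_add_left, inner_add_right]
        ring
      map_smul' := by
        intro r a
        simp only [map_smul, smul_apply, real_inner_smul_left,
          real_inner_smul_right, smul_eq_mul, RingHom.id_apply]
        ring }
  have hφ : ∀ s v t, φ s v t = T s t v + T v t s - T s v t - inner ℝ (τ v s) t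
              + inner ℝ (τ s t) v - inner ℝ (τ t v) s := fun _ _ _ => rfl
  let B : V →ₗ[ℝ] V →ₗ[ℝ] V := LinearMap.mk₂ ℝ
    (fun s v => (InnerProductSpace.toDual ℝ V).symm ((1 / 2 : ℝ) • φ s v))
    (by
      intro a b v
      rw [← map_add]
      congr 1
      ext t
      simp only [hφ, map_add, add_apply, smul_apply, inner_add_left, inner_add_right, smul_eq_mul]
      ring)
    (by
      intro r a v
      apply (InnerProductSpace.toDual ℝ V).injective
      rw [map_smulₛₗ]
      ext t
      simp [hφ, real_inner_smul_left, real_inner_smul_right]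
      ring)
    (by
      intro a v w
      rw [← map_add]
      congr 1
      ext t
      simp only [hφ, map_add, add_apply, smul_apply, inner_add_left, inner_add_right, smul_eq_mul]
      ring)
    (by
      intro r a v
      apply (InnerProductSpace.toDual ℝ V).injective
      rw [map_smulₛₗ]
      ext t
      simp [hφ, real_inner_smul_left, real_inner_smul_right]
      ring)
  have hB : ∀ s v t, inner ℝ (B s v) t = (1 / 2 : ℝ) * (T s t v + T v t s - T s v t
      - inner ℝ (τ v s) t + inner ℝ (τ s t) v - inner ℝ (τ t v) s) := by
    intro s v t
    have : B s v = (InnerProductSpace.toDual ℝ V).symm ((1 / 2 : ℝ) • φ s v) := rfl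
    rw [this, InnerProductSpace.toDual_symm_apply]
    simp [hφ]
  refine ⟨B.toContinuousBilinearMap, fun s t v => ?_, fun u v => ?_⟩
  · change inner ℝ (B s v) t + inner ℝ s (B t v) = _
    rw [real_inner_comm (B t v) s, hB, hB, hT t s v, hT v t s, hT v s t, hτ v s, hτ t s, hτ t v]
    simp only [inner_neg_left]
    ring
  · change τ u v + B v u - B u v = 0
    apply ext_inner_right ℝ
    intro t
    rw [inner_sub_left, inner_add_left, hB, hB, hT v t u, hT u t v, hT v u t, hτ v u, hτ t u,
      hτ t v]
    simp only [inner_neg_left, inner_zero_left]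
    rw [hT t v u, hT t u v]
    ring

end DistGeom

end

open Bundle
open scoped Manifold ContDiff

noncomputable section

namespace DistGeom

section Existence

open FiberBundle Module

lemma mvfderiv_congr {m : ℕ} {M : Type*} [TopologicalSpace M]
    [ChartedSpace (EuclideanSpace ℝ (Fin m)) M] {F : Type*} [NormedAddCommGroup F]
    [NormedSpace ℝ F] {f g : M → F} {x : M}
    (h : f =ᶠ[nhds x] g) : mvfderiv (𝓡 m) f x = mvfderiv (𝓡 m) g x := by
  have h1 := h.mfderiv_eq (I := 𝓡 m) (I' := 𝓘(ℝ, F))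
  ext v
  simp only [mvfderiv, h1, ContinuousLinearMap.comp_apply]
  rfl

variable {m : ℕ} {M : Type*} [TopologicalSpace M] [ChartedSpace (EuclideanSpace ℝ (Fin m)) M]
  [IsManifold (𝓡 m) ∞ M]

variable (m M) in
/-- The covariant derivative (not invariantly defined) which at each point `x` differentiates the
coordinates of a vector field in the preferred chart at `x`. It only serves as a starting point for
the construction of the Levi-Civita connection. -/
def coordinateConnection :
    CovariantDerivative (𝓡 m) (EuclideanSpace ℝ (Fin m)) (fun x : M => TangentSpace (𝓡 m) x) where
  toFun σ x :=
    ((trivializationAt (EuclideanSpace ℝ (Fin m))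
        (fun x : M => TangentSpace (𝓡 m) x) x).symmL ℝ x).comp
      (mvfderiv (𝓡 m) (fun y =>
        (trivializationAt (EuclideanSpace ℝ (Fin m)) (fun x : M => TangentSpace (𝓡 m) x) x
          ⟨y, σ y⟩).2) x)
  isCovariantDerivativeOnUniv := by
    constructor
    · intro σ σ' x hσ hσ' _
      set e := trivializationAt (EuclideanSpace ℝ (Fin m)) (fun x : M => TangentSpace (𝓡 m) x) x
      have hx : e.baseSet ∈ nhds x := e.open_baseSet.mem_nhds
        (FiberBundle.mem_baseSet_trivializationAt' x)
      have h1 := (mdifferentiableAt_section _ _).1 hσ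
      have h2 := (mdifferentiableAt_section _ _).1 hσ'
      rw [← ContinuousLinearMap.comp_add, ← mvfderiv_add h1 h2]
      congr 1
      apply mvfderiv_congr
      filter_upwards [hx] with y hy
      exact (e.linear ℝ hy).map_add (σ y) (σ' y)
    · intro σ g x hσ hg _
      set e := trivializationAt (EuclideanSpace ℝ (Fin m)) (fun x : M => TangentSpace (𝓡 m) x) x
      have hxx : x ∈ e.baseSet := FiberBundle.mem_baseSet_trivializationAt' x
      have hx : e.baseSet ∈ nhds x := e.open_baseSet.mem_nhds hxx
      have h1 := (mdifferentiableAt_section _ _).1 hσ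
      have key : mvfderiv (𝓡 m) (fun y => (e ⟨y, (g • σ) y⟩).2) x =
          mvfderiv (𝓡 m) (g • fun y => (e ⟨y, σ y⟩).2) x := by
        apply mvfderiv_congr
        filter_upwards [hx] with y hy
        exact (e.linear ℝ hy).map_smul (g y) (σ y)
      rw [key, mvfderiv_smul hg h1]
      ext v
      have h2 : e.symmL ℝ x (e ⟨x, σ x⟩).2 = σ x := by
        rw [Trivialization.symmL_apply _ hxx, e.symm_apply_apply_mk hxx (σ x)]
      change e.symmL ℝ x (g x • mvfderiv (𝓡 m) (fun y => (e ⟨y, σ y⟩).2) x v +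
          mvfderiv (𝓡 m) g x v • (e ⟨x, σ x⟩).2) =
        g x • e.symmL ℝ x (mvfderiv (𝓡 m) (fun y => (e ⟨y, σ y⟩).2) x v) +
          mvfderiv (𝓡 m) g x v • σ x
      rw [map_add, map_smul, map_smul, h2]

variable [RiemannianBundle (fun x : M => TangentSpace (𝓡 m) x)]
  [IsContMDiffRiemannianBundle (𝓡 m) ∞ (EuclideanSpace ℝ (Fin m))
    (fun x : M => TangentSpace (𝓡 m) x)]

instance isContMDiffRiemannianBundle_one : IsContMDiffRiemannianBundle (𝓡 m) 1
    (EuclideanSpace ℝ (Fin m)) (fun x : M => TangentSpace (𝓡 m) x) :=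
  .of_le (n := ∞) (by norm_cast)

/-- A covariant derivative on `TM` is a Levi-Civita connection if it is compatible with the metric
and torsion free. -/
def IsLeviCivita (nab : CovariantDerivative (𝓡 m) (EuclideanSpace ℝ (Fin m))
    (fun x : M => TangentSpace (𝓡 m) x)) : Prop :=
  nab.IsMetricCompatible ∧ nab.torsion = 0

variable (m M) in
theorem exists_isLeviCivita : ∃ nab : CovariantDerivative (𝓡 m) (EuclideanSpace ℝ (Fin m))
    (fun x : M => TangentSpace (𝓡 m) x), IsLeviCivita nab := by
  set c := coordinateConnection m M
  have hsymm : ∀ (x : M) (s t v : TangentSpace (𝓡 m) x),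
      c.derivMetricTensor x s t v = c.derivMetricTensor x t s v := by
    intro x s t v
    rw [CovariantDerivative.derivMetricTensor_apply_eq_extend,
      CovariantDerivative.derivMetricTensor_apply_eq_extend]
    have : (fun y => inner ℝ (extend (EuclideanSpace ℝ (Fin m)) s y)
        (extend (EuclideanSpace ℝ (Fin m)) t y)) =
        (fun y => inner ℝ (extend (EuclideanSpace ℝ (Fin m)) t y)
        (extend (EuclideanSpace ℝ (Fin m)) s y)) := by
      ext y; exact real_inner_comm _ _
    rw [this, real_inner_comm t, real_inner_comm s]
    ring
  have hA : ∀ x : M, ∃ A : TangentSpace (𝓡 m) x →L[ℝ] TangentSpace (𝓡 m) x →L[ℝ]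
      TangentSpace (𝓡 m) x,
      (∀ s t v, inner ℝ (A s v) t + inner ℝ s (A t v) = c.derivMetricTensor x s t v) ∧
      (∀ u v, c.torsion x u v + A v u - A u v = 0) := by
    intro x
    have : FiniteDimensional ℝ (TangentSpace (𝓡 m) x) :=
      inferInstanceAs (FiniteDimensional ℝ (EuclideanSpace ℝ (Fin m)))
    exact exists_koszul_correction (c.derivMetricTensor x) (c.torsion x) (hsymm x)
      (fun u v => c.torsion_antisymm u v)
  choose A hA1 hA2 using hA
  have hcoe : ∀ (σ : ∀ x : M, TangentSpace (𝓡 m) x) (x : M) (v : TangentSpace (𝓡 m) x),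
      (c.addOneForm A) σ x v = c σ x v + A x (σ x) v := fun _ _ _ => rfl
  refine ⟨c.addOneForm A, ?_, ?_⟩
  · rw [CovariantDerivative.isMetricCompatible_iff]
    intro x X σ τ _ hσ hτ
    have h1 := c.derivMetricTensor_apply (X := X) x hσ hτ
    have h2 := hA1 x (σ x) (τ x) (X x)
    simp only [hcoe, inner_add_left, inner_add_right]
    linarith
  · rw [CovariantDerivative.torsion_eq_zero_iff]
    intro X Y x hX hY
    have h1 := c.torsion_apply hX hY
    have h2 := hA2 x (X x) (Y x)
    rw [hcoe, hcoe]
    rw [h1] at h2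
    rw [← sub_eq_zero, ← h2]
    abel

variable (m M) in
/-- The Levi-Civita connection `∇` of the Riemannian manifold `M`; in Mathlib's convention
`(∇_X Y) p` is `leviCivita m M Y p (X p)`. -/
def leviCivita : CovariantDerivative (𝓡 m) (EuclideanSpace ℝ (Fin m))
    (fun x : M => TangentSpace (𝓡 m) x) :=
  (exists_isLeviCivita m M).choose

variable (m M) in
theorem leviCivita_spec : IsLeviCivita (leviCivita m M) :=
  (exists_isLeviCivita m M).choose_spec

end Existence

section Distribution

/-- A regular distribution of rank `n` on `M`: a smooth subbundle of `TM` of constant rank `n`,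
that is, a family of subspaces of the tangent spaces which locally has a smooth frame consisting of
`n` pointwise linearly independent vector fields. -/
structure RegularDistribution (m : ℕ) (M : Type*) [TopologicalSpace M]
    [ChartedSpace (EuclideanSpace ℝ (Fin m)) M] [IsManifold (𝓡 m) ∞ M] (n : ℕ) where
  /-- The fibre `D_p ⊆ T_p M`. -/
  fiber : ∀ p : M, Submodule ℝ (TangentSpace (𝓡 m) p)
  exists_frame : ∀ p : M, ∃ U : Set M, IsOpen U ∧ p ∈ U ∧
    ∃ X : Fin n → ∀ x : M, TangentSpace (𝓡 m) x,
      (∀ i, ContMDiffOn (𝓡 m) ((𝓡 m).prod 𝓘(ℝ, EuclideanSpace ℝ (Fin m))) ∞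
        (fun x => TotalSpace.mk' (EuclideanSpace ℝ (Fin m)) x (X i x)) U) ∧
      ∀ x ∈ U, LinearIndependent ℝ (fun i => X i x) ∧
        Submodule.span ℝ (Set.range fun i => X i x) = fiber x

variable {m n : ℕ} {M : Type*} [TopologicalSpace M] [ChartedSpace (EuclideanSpace ℝ (Fin m)) M]
  [IsManifold (𝓡 m) ∞ M]

/-- `Γ(D)`: the smooth vector fields on `M` with values in `D`. -/
def RegularDistribution.sections (D : RegularDistribution m M n) :
    Set (∀ x : M, TangentSpace (𝓡 m) x) :=
  {X | ContMDiff (𝓡 m) ((𝓡 m).prod 𝓘(ℝ, EuclideanSpace ℝ (Fin m))) ∞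
      (fun x => TotalSpace.mk' (EuclideanSpace ℝ (Fin m)) x (X x)) ∧ ∀ p, X p ∈ D.fiber p}

/-- The velocity `γ'(t) ∈ T_{γ(t)} M` of a curve. -/
def velocity (m : ℕ) {M : Type*} [TopologicalSpace M] [ChartedSpace (EuclideanSpace ℝ (Fin m)) M]
    (γ : ℝ → M) (t : ℝ) : TangentSpace (𝓡 m) (γ t) :=
  mfderiv 𝓘(ℝ, ℝ) (𝓡 m) γ t (1 : ℝ)

/-- The covariant derivative `∇_{γ'} V` at time `t` of a vector field `V` along the curve `γ`,
for a connection `∇` on `TM`. Let `E_1, …, E_m` be the coordinate frame of the preferred chart at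
the point `γ(t)`, and write `V(s) = ∑ V^j(s) E_j(γ(s))`. Then
`∇_{γ'} V (t) = ∑ (V^j)'(t) E_j(γ(t)) + ∑ V^j(t) (∇_{γ'(t)} E_j)`, and the second sum is
`∇_{γ'(t)} Ṽ`, where `Ṽ = ∑ V^j(t) E_j = FiberBundle.extend (V t)` is the field with constant
coefficients that extends the vector `V(t)`. -/
def covDerivAlong (nab : CovariantDerivative (𝓡 m) (EuclideanSpace ℝ (Fin m))
      (fun x : M => TangentSpace (𝓡 m) x))
    (γ : ℝ → M) (V : ∀ t : ℝ, TangentSpace (𝓡 m) (γ t)) (t : ℝ) : TangentSpace (𝓡 m) (γ t) :=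
  (trivializationAt (EuclideanSpace ℝ (Fin m)) (fun x : M => TangentSpace (𝓡 m) x) (γ t)).symm (γ t)
      (deriv (fun s => (trivializationAt (EuclideanSpace ℝ (Fin m))
        (fun x : M => TangentSpace (𝓡 m) x) (γ t) ⟨γ s, V s⟩).2) t)
    + nab (FiberBundle.extend (EuclideanSpace ℝ (Fin m)) (V t)) (γ t) (velocity m γ t)

/-- `γ` restricted to `J` is a smooth curve defined on the open interval `J`. -/
def IsSmoothCurveOn (m : ℕ) {M : Type*} [TopologicalSpace M]
    [ChartedSpace (EuclideanSpace ℝ (Fin m)) M] (γ : ℝ → M) (J : Set ℝ) : Prop :=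
  IsOpen J ∧ J.OrdConnected ∧ ContMDiffOn 𝓘(ℝ, ℝ) (𝓡 m) ∞ γ J

variable [RiemannianBundle (fun x : M => TangentSpace (𝓡 m) x)]

/-- The orthogonal projection `π^D : T_p M → D_p`, as an endomorphism of `T_p M`. -/
def RegularDistribution.proj (D : RegularDistribution m M n) (p : M) :
    TangentSpace (𝓡 m) p →L[ℝ] TangentSpace (𝓡 m) p :=
  haveI : FiniteDimensional ℝ (TangentSpace (𝓡 m) p) :=
    inferInstanceAs (FiniteDimensional ℝ (EuclideanSpace ℝ (Fin m)))
  (D.fiber p).starProjection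

variable [IsContMDiffRiemannianBundle (𝓡 m) ∞ (EuclideanSpace ℝ (Fin m))
    (fun x : M => TangentSpace (𝓡 m) x)]

/-- `∇_X Y` for the Levi-Civita connection `∇`. -/
def nabla (X Y : ∀ x : M, TangentSpace (𝓡 m) x) : ∀ x : M, TangentSpace (𝓡 m) x :=
  fun p => leviCivita m M Y p (X p)

/-- The intrinsic connection `∇^D_X Y = π^D (∇_X Y)` of the distribution `D`. -/
def RegularDistribution.nabla (D : RegularDistribution m M n)
    (X Y : ∀ x : M, TangentSpace (𝓡 m) x) : ∀ x : M, TangentSpace (𝓡 m) x :=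
  fun p => D.proj p (DistGeom.nabla X Y p)

/-- The second fundamental form `B(X, Y) = ∇_X Y - ∇^D_X Y` of `D`. -/
def RegularDistribution.secondFundamentalForm (D : RegularDistribution m M n)
    (X Y : ∀ x : M, TangentSpace (𝓡 m) x) : ∀ x : M, TangentSpace (𝓡 m) x :=
  fun p => DistGeom.nabla X Y p - D.nabla X Y p

/-- The symmetric part `B^s(X, Y) = (B(X, Y) + B(Y, X)) / 2` of the second fundamental form. -/
def RegularDistribution.symmSecondFundamentalForm (D : RegularDistribution m M n)
    (X Y : ∀ x : M, TangentSpace (𝓡 m) x) : ∀ x : M, TangentSpace (𝓡 m) x :=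
  fun p => (1 / 2 : ℝ) • (D.secondFundamentalForm X Y p + D.secondFundamentalForm Y X p)

/-- The acceleration `∇_{γ'} γ'` of a curve. -/
def acceleration (m : ℕ) {M : Type*} [TopologicalSpace M]
    [ChartedSpace (EuclideanSpace ℝ (Fin m)) M] [IsManifold (𝓡 m) ∞ M]
    [RiemannianBundle (fun x : M => TangentSpace (𝓡 m) x)]
    [IsContMDiffRiemannianBundle (𝓡 m) ∞ (EuclideanSpace ℝ (Fin m))
      (fun x : M => TangentSpace (𝓡 m) x)]
    (γ : ℝ → M) (t : ℝ) : TangentSpace (𝓡 m) (γ t) :=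
  covDerivAlong (leviCivita m M) γ (velocity m γ) t

/-- `γ : J → M` is a `∇`-geodesic: a smooth curve with `∇_{γ'} γ' = 0`. -/
def IsGeodesicOn (m : ℕ) {M : Type*} [TopologicalSpace M]
    [ChartedSpace (EuclideanSpace ℝ (Fin m)) M] [IsManifold (𝓡 m) ∞ M]
    [RiemannianBundle (fun x : M => TangentSpace (𝓡 m) x)]
    [IsContMDiffRiemannianBundle (𝓡 m) ∞ (EuclideanSpace ℝ (Fin m))
      (fun x : M => TangentSpace (𝓡 m) x)]
    (γ : ℝ → M) (J : Set ℝ) : Prop :=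
  IsSmoothCurveOn m γ J ∧ ∀ t ∈ J, acceleration m γ t = 0

/-- `γ : J → M` is a `∇^D`-geodesic: a smooth curve tangent to `D` with `∇^D_{γ'} γ' = 0`.
For curves tangent to `D` the covariant derivative induced by the connection `∇^D = π^D ∘ ∇` is
`∇^D_{γ'} γ' = π^D (∇_{γ'} γ')`. -/
def RegularDistribution.IsGeodesicOn (D : RegularDistribution m M n) (γ : ℝ → M) (J : Set ℝ) :
    Prop :=
  IsSmoothCurveOn m γ J ∧ (∀ t ∈ J, velocity m γ t ∈ D.fiber (γ t)) ∧
    ∀ t ∈ J, D.proj (γ t) (acceleration m γ t) = 0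

/-- `D` is totally geodesic: every `∇`-geodesic whose velocity lies in `D` at some (initial) time is
tangent to `D` at all times. -/
def RegularDistribution.IsTotallyGeodesic (D : RegularDistribution m M n) : Prop :=
  ∀ (γ : ℝ → M) (J : Set ℝ), DistGeom.IsGeodesicOn m γ J →
    ∀ t₀ ∈ J, velocity m γ t₀ ∈ D.fiber (γ t₀) → ∀ t ∈ J, velocity m γ t ∈ D.fiber (γ t)

end Distribution

end DistGeom

end

/-! The condition `∇_X X ∈ Γ(D)` is the hub through which every implication passes.

Let `γ` be tangent to `D`, and let the section `X` of `D` extend its velocity at one time. There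
`∇_{γ'} γ'` and `∇_X X` agree modulo `D` (`acceleration_sub_nabla_mem`): in an orthonormal frame
adapted to `D` they differ only by derivatives of coefficients, and the normal coefficients of both
fields vanish along `γ`. So if `∇_X X` always lies in `D`, the acceleration of a curve tangent to
`D` equals its own projection, and `∇^D`-geodesics are `∇`-geodesics. Conversely, a `∇`-geodesic
tangent to `D` with velocity `X p` forces `∇_X X` into `D` at `p` (`nabla_self_mem`). Such a curve
comes from `exists_geodesic`, applied to `D` when `∇^D`-geodesics are `∇`-geodesics, and to `TM`
when `D` is totally geodesic.

That the hub implies total geodesy is an ODE argument. Split the frame coefficients of the velocity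
of a geodesic into a tangential part `a` and a normal part `w`. The terms quadratic in `a` drop out
of the equation for `w` (`sum_frameSymbol_eq_zero`), leaving a linear system. If `w` vanishes once
it vanishes nearby, and connectedness of the interval finishes.

The conditions on `B^s` and on `∇_X Y + ∇_Y X` are tied to the hub by polarization. Smoothness of
`∇_X Y` follows from the Koszul formula. -/

noncomputable section

namespace DistGeom

open FiberBundle Module VectorField Filter Topology

/-! ### Covariant differentiation along curves -/

section Connection

variable {m : ℕ} {M : Type*} [TopologicalSpace M] [ChartedSpace (EuclideanSpace ℝ (Fin m)) M]
  [IsManifold (𝓡 m) ∞ M]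

/-- The vector field `X` is smooth on the set `U`. -/
abbrev SmoothFieldOn (X : ∀ x : M, TangentSpace (𝓡 m) x) (U : Set M) : Prop :=
  ContMDiffOn (𝓡 m) ((𝓡 m).prod 𝓘(ℝ, EuclideanSpace ℝ (Fin m))) ∞
    (fun x => TotalSpace.mk' (EuclideanSpace ℝ (Fin m)) x (X x)) U

/-- The vector field `X` is differentiable at the point `x`. -/
abbrev DiffFieldAt (X : ∀ x : M, TangentSpace (𝓡 m) x) (x : M) : Prop :=
  MDifferentiableAt (𝓡 m) ((𝓡 m).prod 𝓘(ℝ, EuclideanSpace ℝ (Fin m)))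
    (fun x => TotalSpace.mk' (EuclideanSpace ℝ (Fin m)) x (X x)) x

lemma SmoothFieldOn.diffFieldAt {X : ∀ x : M, TangentSpace (𝓡 m) x} {U : Set M}
    (hX : SmoothFieldOn X U) (hU : IsOpen U) {x : M} (hx : x ∈ U) : DiffFieldAt X x :=
  (hX.contMDiffAt (hU.mem_nhds hx)).mdifferentiableAt (by simp)

/-- The coordinate connection kills fields with constant coordinates. -/
lemma coordinateConnection_extend {x : M} (v : TangentSpace (𝓡 m) x) :
    coordinateConnection m M (extend (EuclideanSpace ℝ (Fin m)) v) x = 0 := by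
  set e := trivializationAt (EuclideanSpace ℝ (Fin m)) (fun x : M => TangentSpace (𝓡 m) x) x
    with he
  have hx : e.baseSet ∈ 𝓝 x := e.open_baseSet.mem_nhds (mem_baseSet_trivializationAt' x)
  have h : (fun y => (e ⟨y, extend (EuclideanSpace ℝ (Fin m)) v y⟩).2) =ᶠ[𝓝 x]
      fun _ => (e ⟨x, v⟩).2 := by
    filter_upwards [hx] with y hy
    change (e ⟨y, e.symm y (e ⟨x, v⟩).2⟩).2 = _
    rw [e.apply_mk_symm hy]
  change (e.symmL ℝ x).comp (mvfderiv (𝓡 m) _ x) = 0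
  rw [mvfderiv_congr h, mvfderiv_const, ContinuousLinearMap.comp_zero]

variable (nab : CovariantDerivative (𝓡 m) (EuclideanSpace ℝ (Fin m))
    (fun x : M => TangentSpace (𝓡 m) x))

/-- The Christoffel tensor of a connection at `x` in the preferred chart at `x`. -/
def christoffel (x : M) :
    TangentSpace (𝓡 m) x →L[ℝ] TangentSpace (𝓡 m) x →L[ℝ] TangentSpace (𝓡 m) x :=
  nab.difference (coordinateConnection m M) x

lemma connection_eq_add_christoffel {x : M} {Y : ∀ x : M, TangentSpace (𝓡 m) x}
    (hY : DiffFieldAt Y x) :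
    nab Y x = coordinateConnection m M Y x + christoffel nab x (Y x) := by
  have h := nab.isCovariantDerivativeOnUniv.difference_apply
    (coordinateConnection m M).isCovariantDerivativeOnUniv (x := x) trivial hY
  exact eq_add_of_sub_eq' h.symm

/-- This evaluates the second term in the definition of `covDerivAlong`. -/
lemma connection_extend {x : M} (v : TangentSpace (𝓡 m) x) :
    nab (extend (EuclideanSpace ℝ (Fin m)) v) x = christoffel nab x v := by
  rw [connection_eq_add_christoffel nab
    (mdifferentiableAt_extend (𝓡 m) (EuclideanSpace ℝ (Fin m)) v),
    coordinateConnection_extend, zero_add, extend_apply_self]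

/-- The covariant derivative along `γ` of a combination `∑ f_i Y_i` of vector fields with
time-dependent coefficients. -/
theorem covDerivAlong_eq_sum {ι : Type*} [Fintype ι] {γ : ℝ → M}
    {V : ∀ t : ℝ, TangentSpace (𝓡 m) (γ t)} {t : ℝ}
    (hγ : MDifferentiableAt 𝓘(ℝ, ℝ) (𝓡 m) γ t) {f : ι → ℝ → ℝ} {f' : ι → ℝ}
    {Y : ι → ∀ x : M, TangentSpace (𝓡 m) x} (hf : ∀ i, HasDerivAt (f i) (f' i) t)
    (hY : ∀ i, DiffFieldAt (Y i) (γ t)) (hV : ∀ᶠ s in 𝓝 t, V s = ∑ i, f i s • Y i (γ s)) :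
    covDerivAlong nab γ V t =
      ∑ i, (f' i • Y i (γ t) + f i t • nab (Y i) (γ t) (velocity m γ t)) := by
  set e := trivializationAt (EuclideanSpace ℝ (Fin m)) (fun x : M => TangentSpace (𝓡 m) x) (γ t)
    with he
  have hmem : γ t ∈ e.baseSet := mem_baseSet_trivializationAt' (γ t)
  have hx : e.baseSet ∈ 𝓝 (γ t) := e.open_baseSet.mem_nhds hmem
  -- Chain rule for the coordinates of `Y i` along `γ`.
  have hg : ∀ i, HasDerivAt (fun s => (e ⟨γ s, Y i (γ s)⟩).2)
      (mvfderiv (𝓡 m) (fun y => (e ⟨y, Y i y⟩).2) (γ t) (velocity m γ t)) t := by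
    intro i
    have h1 := (mdifferentiableAt_section _ _).1 (hY i)
    have h2 : HasFDerivAt (𝕜 := ℝ) (E := ℝ) (F := EuclideanSpace ℝ (Fin m))
        (fun s => (e ⟨γ s, Y i (γ s)⟩).2)
        ((mvfderiv (𝓡 m) (fun y => (e ⟨y, Y i y⟩).2) (γ t)).comp
          (mfderiv 𝓘(ℝ, ℝ) (𝓡 m) γ t)) t :=
      (h1.hasMFDerivAt.comp t hγ.hasMFDerivAt).hasFDerivAt
    exact h2.hasDerivAt
  have hd : HasDerivAt (fun s => (e ⟨γ s, V s⟩).2)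
      (∑ i, (f i t • mvfderiv (𝓡 m) (fun y => (e ⟨y, Y i y⟩).2) (γ t) (velocity m γ t)
        + f' i • (e ⟨γ t, Y i (γ t)⟩).2)) t := by
    refine (HasDerivAt.fun_sum fun i _ => (hf i).smul (hg i)).congr_of_eventuallyEq ?_
    filter_upwards [hV, hγ.continuousAt hx] with s hs hs2
    rw [hs]
    have := map_sum (e.linearMapAt ℝ (γ s)) (fun i => f i s • Y i (γ s)) Finset.univ
    rw [e.coe_linearMapAt_of_mem hs2] at this
    refine this.trans (Finset.sum_congr rfl fun i _ => ?_)
    exact (e.linear ℝ hs2).map_smul (f i s) (Y i (γ s))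
  have hsymm : ∀ v, e.symm (γ t) v = e.symmL ℝ (γ t) v := fun v =>
    (Trivialization.symmL_apply _ hmem v).symm
  have h2 : ∀ i, e.symmL ℝ (γ t) (e ⟨γ t, Y i (γ t)⟩).2 = Y i (γ t) := fun i => by
    rw [Trivialization.symmL_apply _ hmem, e.symm_apply_apply_mk hmem]
  -- The Christoffel term is linear in `V t`; its `i`-th piece joins the coordinate derivative of `Y
  -- i` to form `nab (Y i)`.
  rw [covDerivAlong, ← he, hd.deriv, connection_extend, hV.self_of_nhds, hsymm, map_sum, map_sum,
    sum_apply, ← Finset.sum_add_distrib]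
  refine Finset.sum_congr rfl fun i _ => ?_
  rw [connection_eq_add_christoffel nab (hY i), map_add, map_smul, map_smul, map_smul, h2,
    add_apply, smul_apply, smul_add]
  have h3 : e.symmL ℝ (γ t) (mvfderiv (𝓡 m) (fun y => (e ⟨y, Y i y⟩).2) (γ t) (velocity m γ t)) =
    coordinateConnection m M (Y i) (γ t) (velocity m γ t) := rfl
  rw [h3]
  abel

end Connection

/-! ### Orthonormal frames adapted to the distribution -/

section Frame

variable {m n : ℕ} {M : Type*} [TopologicalSpace M] [ChartedSpace (EuclideanSpace ℝ (Fin m)) M]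

instance finiteDimensional_tangentSpace (x : M) : FiniteDimensional ℝ (TangentSpace (𝓡 m) x) :=
  inferInstanceAs (FiniteDimensional ℝ (EuclideanSpace ℝ (Fin m)))

lemma finrank_tangentSpace (x : M) : finrank ℝ (TangentSpace (𝓡 m) x) = m :=
  (finrank_euclideanSpace_fin : finrank ℝ (EuclideanSpace ℝ (Fin m)) = m)

lemma sum_inner_smul_eq [RiemannianBundle (fun x : M => TangentSpace (𝓡 m) x)] {x : M}
    {F : Fin m → TangentSpace (𝓡 m) x}
    (hF : Orthonormal ℝ F) (v : TangentSpace (𝓡 m) x) : ∑ i, inner ℝ (F i) v • F i = v := by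
  have hcard : Fintype.card (Fin m) = finrank ℝ (TangentSpace (𝓡 m) x) := by
    rw [finrank_tangentSpace, Fintype.card_fin]
  have hspan := hF.linearIndependent.span_eq_top_of_card_eq_finrank' hcard
  simpa only [OrthonormalBasis.coe_mk] using (OrthonormalBasis.mk hF hspan.ge).sum_repr' v

variable [IsManifold (𝓡 m) ∞ M]

/-- Linear independence of a finite family of continuous vector fields is an open condition. -/
lemma eventually_linearIndependent {ι : Type*} [Finite ι]
    {Z : ι → ∀ x : M, TangentSpace (𝓡 m) x} {p : M}
    (hZ : ∀ i, ContMDiffAt (𝓡 m) ((𝓡 m).prod 𝓘(ℝ, EuclideanSpace ℝ (Fin m))) ∞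
      (fun x => TotalSpace.mk' (EuclideanSpace ℝ (Fin m)) x (Z i x)) p)
    (h : LinearIndependent ℝ fun i => Z i p) :
    ∀ᶠ x in 𝓝 p, LinearIndependent ℝ fun i => Z i x := by
  set e := trivializationAt (EuclideanSpace ℝ (Fin m)) (fun x : M => TangentSpace (𝓡 m) x) p
  have hmem : p ∈ e.baseSet := mem_baseSet_trivializationAt' p
  have key : ∀ x ∈ e.baseSet, LinearIndependent ℝ (fun i => (e ⟨x, Z i x⟩).2) ↔
      LinearIndependent ℝ fun i => Z i x := fun x hx =>
    (e.linearEquivAt ℝ x hx).toLinearMap.linearIndependent_iff (v := fun i => Z i x)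
      (LinearEquiv.ker _)
  have hc : ContinuousAt (fun x i => (e ⟨x, Z i x⟩).2) p :=
    continuousAt_pi.2 fun i => ((contMDiffAt_section _).1 (hZ i)).continuousAt
  filter_upwards [hc.eventually (isOpen_setOfPred_linearIndependent.mem_nhds ((key p hmem).2 h)),
    e.open_baseSet.mem_nhds hmem] with x hx hx2
  exact (key x hx2).1 hx

lemma SmoothFieldOn.smul {X : ∀ x : M, TangentSpace (𝓡 m) x} {f : M → ℝ} {U : Set M}
    (hf : ContMDiffOn (𝓡 m) 𝓘(ℝ) ∞ f U) (hX : SmoothFieldOn X U) :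
    SmoothFieldOn (fun x => f x • X x) U :=
  ContMDiffOn.smul_section hf hX

lemma SmoothFieldOn.sum {ι : Type*} {s : Finset ι} {X : ι → ∀ x : M, TangentSpace (𝓡 m) x}
    {U : Set M} (hX : ∀ i ∈ s, SmoothFieldOn (X i) U) :
    SmoothFieldOn (fun x => ∑ i ∈ s, X i x) U :=
  ContMDiffOn.sum_section hX

variable [RiemannianBundle (fun x : M => TangentSpace (𝓡 m) x)]
  [IsContMDiffRiemannianBundle (𝓡 m) ∞ (EuclideanSpace ℝ (Fin m))
    (fun x : M => TangentSpace (𝓡 m) x)]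

lemma SmoothFieldOn.contMDiffOn_inner {X Y : ∀ x : M, TangentSpace (𝓡 m) x} {U : Set M}
    (hX : SmoothFieldOn X U) (hY : SmoothFieldOn Y U) :
    ContMDiffOn (𝓡 m) 𝓘(ℝ) ∞ (fun x => inner ℝ (X x) (Y x)) U :=
  ContMDiffOn.inner_bundle (F := EuclideanSpace ℝ (Fin m))
    (E := fun x : M => TangentSpace (𝓡 m) x) (b := id) hX hY

/-- Strong induction on the recursive formula, whose denominators are nonzero by linear
independence. -/
lemma SmoothFieldOn.gramSchmidt {k : ℕ} {Z : Fin k → ∀ x : M, TangentSpace (𝓡 m) x} {U : Set M}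
    (hZ : ∀ i, SmoothFieldOn (Z i) U) (h : ∀ x ∈ U, LinearIndependent ℝ fun i => Z i x)
    (i : Fin k) :
    SmoothFieldOn (fun x => InnerProductSpace.gramSchmidt ℝ (fun j => Z j x) i) U := by
  induction i using WellFoundedLT.induction with
  | ind i ih =>
    have hne : ∀ j, ∀ x ∈ U, ‖InnerProductSpace.gramSchmidt ℝ (fun j => Z j x) j‖ ^ 2 ≠ 0 :=
      fun j x hx => pow_ne_zero 2
        (norm_ne_zero_iff.2 (InnerProductSpace.gramSchmidt_ne_zero j (h x hx)))
    have hs : SmoothFieldOn (fun x => ∑ j ∈ Finset.Iio i,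
        (inner ℝ (InnerProductSpace.gramSchmidt ℝ (fun j => Z j x) j) (Z i x) /
          ‖InnerProductSpace.gramSchmidt ℝ (fun j => Z j x) j‖ ^ 2) •
          InnerProductSpace.gramSchmidt ℝ (fun j => Z j x) j) U := by
      refine SmoothFieldOn.sum fun j hj => ?_
      have hj' := ih j (Finset.mem_Iio.1 hj)
      refine SmoothFieldOn.smul ((hj'.contMDiffOn_inner (hZ i)).div₀ ?_ (hne j)) hj'
      exact (hj'.contMDiffOn_inner hj').congr fun x _ => (real_inner_self_eq_norm_sq _).symm
    refine ((hZ i).sub_section hs).congr fun x _ => ?_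
    congr 1
    have := InnerProductSpace.gramSchmidt_def'' ℝ (fun j => Z j x) i
    exact eq_sub_of_add_eq this.symm

lemma SmoothFieldOn.gramSchmidtNormed {k : ℕ} {Z : Fin k → ∀ x : M, TangentSpace (𝓡 m) x}
    {U : Set M} (hZ : ∀ i, SmoothFieldOn (Z i) U)
    (h : ∀ x ∈ U, LinearIndependent ℝ fun i => Z i x) (i : Fin k) :
    SmoothFieldOn (fun x => InnerProductSpace.gramSchmidtNormed ℝ (fun j => Z j x) i) U := by
  have hg := SmoothFieldOn.gramSchmidt hZ h i
  have hne : ∀ x ∈ U, InnerProductSpace.gramSchmidt ℝ (fun j => Z j x) i ≠ 0 :=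
    fun x hx => InnerProductSpace.gramSchmidt_ne_zero i (h x hx)
  refine SmoothFieldOn.smul (ContMDiffOn.inv₀ ?_ fun x hx => norm_ne_zero_iff.2 (hne x hx)) hg
  have hn : ∀ (y : M) (w : TangentSpace (𝓡 m) y), ‖w‖ = √(inner ℝ w w) :=
    fun _ w => norm_eq_sqrt_real_inner w
  intro x hx
  have h1 := (hg.contMDiffOn_inner hg) x hx
  have h2 : ContDiffAt ℝ ∞ Real.sqrt (inner ℝ (InnerProductSpace.gramSchmidt ℝ (fun j => Z j x) i)
      (InnerProductSpace.gramSchmidt ℝ (fun j => Z j x) i)) :=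
    Real.contDiffAt_sqrt (inner_self_ne_zero.2 (hne x hx))
  refine (h2.contMDiffAt.comp_contMDiffWithinAt x h1).congr (fun y _ => ?_) ?_ <;>
  exact hn _ _

/-- A smooth orthonormal frame of `TM` over the open set `U` whose first `n` fields span `D`. -/
structure IsAdaptedFrame (D : RegularDistribution m M n)
    (F : Fin m → ∀ x : M, TangentSpace (𝓡 m) x) (U : Set M) : Prop where
  isOpen : IsOpen U
  smooth : ∀ i, SmoothFieldOn (F i) U
  orthonormal : ∀ x ∈ U, Orthonormal ℝ fun i => F i x
  mem_iff : ∀ x ∈ U, ∀ v : TangentSpace (𝓡 m) x,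
    v ∈ D.fiber x ↔ ∀ k : Fin m, n ≤ k → inner ℝ (F k x) v = 0

/-- Complete a local frame of `D` to a basis at `p`, extend the added vectors with constant
coordinates, and apply Gram-Schmidt where the fields stay independent. Gram-Schmidt preserves
initial spans, so the first `n` fields still span `D`. -/
theorem exists_isAdaptedFrame (D : RegularDistribution m M n) (p : M) :
    ∃ F U, p ∈ U ∧ IsAdaptedFrame D F U := by
  obtain ⟨U, hU, hp, X, hX, hspan⟩ := D.exists_frame p
  have hli := (hspan p hp).1
  have hnm : n ≤ m := by
    have := hli.fintype_card_le_finrank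
    rwa [finrank_tangentSpace, Fintype.card_fin] at this
  obtain ⟨b, hb⟩ : ∃ b : Fin m → TangentSpace (𝓡 m) p, LinearIndependent ℝ b ∧
      ∀ i : Fin n, b (Fin.castLE hnm i) = X i p := by
    let B := Basis.sumExtend hli
    have : Finite (Fin n ⊕ Basis.sumExtendIndex hli) := Module.Finite.finite_basis B
    have : Finite (Basis.sumExtendIndex hli) := Finite.sum_right (Fin n)
    have hc : Nat.card (Basis.sumExtendIndex hli) = m - n := by
      have := finrank_eq_nat_card_basis B
      rw [finrank_tangentSpace, Nat.card_sum, Nat.card_fin] at this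
      omega
    let g : Fin m ≃ Fin n ⊕ Basis.sumExtendIndex hli :=
      (finCongr (Nat.add_sub_of_le hnm)).symm.trans (finSumFinEquiv.symm.trans
        (Equiv.sumCongr (Equiv.refl _) (Finite.equivFinOfCardEq hc).symm))
    refine ⟨B ∘ g, B.linearIndependent.comp g g.injective, fun i => ?_⟩
    have hg : g (Fin.castLE hnm i) = Sum.inl i := by
      change Sum.map id _ (finSumFinEquiv.symm (Fin.castAdd (m - n) i)) = _
      rw [finSumFinEquiv_symm_apply_castAdd]
      rfl
    rw [Function.comp_apply, hg]
    simp only [B, Basis.sumExtend, Basis.reindex_apply, Basis.coe_extend]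
    rfl
  set E := EuclideanSpace ℝ (Fin m)
  let Z : Fin m → ∀ x : M, TangentSpace (𝓡 m) x := fun i =>
    if h : i.val < n then X ⟨i, h⟩ else extend E (b i)
  have hZp : ∀ i, Z i p = b i := by
    intro i
    by_cases h : i.val < n
    · simp only [Z, h, dif_pos]
      exact (hb.2 ⟨i, h⟩).symm
    · simp only [Z, h, dif_neg, not_false_eq_true]
      exact extend_apply_self E (b i)
  set e := trivializationAt E (fun x : M => TangentSpace (𝓡 m) x) p with he
  have hZ : ∀ i, SmoothFieldOn (Z i) (U ∩ e.baseSet) := by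
    intro i
    by_cases h : i.val < n
    · simp only [Z, h, dif_pos]
      exact (hX _).mono Set.inter_subset_left
    · simp only [Z, h, dif_neg, not_false_eq_true]
      refine ContMDiffOn.mono ?_ Set.inter_subset_right
      refine (e.contMDiffOn_section_baseSet_iff).2 ?_
      refine (contMDiffOn_const (c := (e ⟨p, b i⟩).2)).congr fun x hx => ?_
      simp only [extend]
      rw [e.apply_mk_symm hx]
  have hO : IsOpen (U ∩ e.baseSet) := hU.inter e.open_baseSet
  have hpO : p ∈ U ∩ e.baseSet := ⟨hp, mem_baseSet_trivializationAt' p⟩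
  have hev : ∀ᶠ x in 𝓝 p, LinearIndependent ℝ fun i => Z i x := by
    refine eventually_linearIndependent (fun i => (hZ i).contMDiffAt (hO.mem_nhds hpO)) ?_
    simp only [hZp]
    exact hb.1
  obtain ⟨W, hW, hWo, hpW⟩ := eventually_nhds_iff.1 hev
  refine ⟨fun i x => InnerProductSpace.gramSchmidtNormed ℝ (fun j => Z j x) i,
    U ∩ e.baseSet ∩ W, ⟨hpO, hpW⟩, hO.inter hWo, ?_, ?_, ?_⟩
  · exact SmoothFieldOn.gramSchmidtNormed (fun i => (hZ i).mono Set.inter_subset_left)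
      fun x hx => hW x hx.2
  · exact fun x hx => InnerProductSpace.gramSchmidtNormed_orthonormal (hW x hx.2)
  · intro x hx v
    set F := InnerProductSpace.gramSchmidtNormed ℝ (fun j => Z j x) with hF
    have hon : Orthonormal ℝ F := InnerProductSpace.gramSchmidtNormed_orthonormal (hW x hx.2)
    have hmem : ∀ i : Fin m, i.val < n → F i ∈ D.fiber x := by
      intro i hi
      refine Submodule.smul_mem _ _ ?_
      have h1 := InnerProductSpace.gramSchmidt_mem_span ℝ (fun j => Z j x) (le_refl i)
      rw [← (hspan x hx.1.1).2]
      refine Submodule.span_mono ?_ h1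
      rintro _ ⟨j, hj, rfl⟩
      have hjn : j.val < n := lt_of_le_of_lt hj hi
      exact ⟨⟨j, hjn⟩, by simp only [Z, hjn, dif_pos]⟩
    have hfr : finrank ℝ (D.fiber x) = n := by
      rw [← (hspan x hx.1.1).2, finrank_span_eq_card (hspan x hx.1.1).1, Fintype.card_fin]
    -- One inclusion is `hmem`; equality follows by counting dimensions.
    have heq : Submodule.span ℝ (Set.range fun i : Fin n => F (Fin.castLE hnm i)) = D.fiber x := by
      apply Submodule.eq_of_le_of_finrank_eq
      · rw [Submodule.span_le]
        rintro _ ⟨i, rfl⟩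
        exact hmem _ i.2
      · rw [finrank_span_eq_card, hfr, Fintype.card_fin]
        exact hon.linearIndependent.comp _ (Fin.castLE_injective hnm)
    constructor
    · intro hv k hk
      rw [← heq] at hv
      induction hv using Submodule.span_induction with
      | mem w hw =>
        obtain ⟨i, rfl⟩ := hw
        refine hon.2 fun h => ?_
        have := congrArg Fin.val h
        have := i.2
        simp at *
        omega
      | zero => exact inner_zero_right _
      | add a b _ _ ha hb => rw [inner_add_right, ha, hb, add_zero]
      | smul r a _ ha => rw [inner_smul_right, ha, mul_zero]
    · intro h
      rw [← sum_inner_smul_eq hon v]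
      refine Submodule.sum_mem _ fun i _ => ?_
      by_cases hi : i.val < n
      · exact Submodule.smul_mem _ _ (hmem i hi)
      · have : inner ℝ (F i) v = 0 := h i (not_lt.1 hi)
        rw [this, zero_smul]
        exact Submodule.zero_mem _

end Frame

/-! ### The Koszul formula and smoothness of the Levi-Civita connection -/

section Smoothness

variable {m n : ℕ} {M : Type*} [TopologicalSpace M] [ChartedSpace (EuclideanSpace ℝ (Fin m)) M]
  [IsManifold (𝓡 m) ∞ M]

variable (m M) in
/-- The distribution `D = TM`. -/
def fullDistribution : RegularDistribution m M m where
  fiber _ := ⊤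
  exists_frame p := by
    set E := EuclideanSpace ℝ (Fin m)
    let e := trivializationAt E (fun x : M => TangentSpace (𝓡 m) x) p
    have h := e.isLocalFrameOn_localFrame_baseSet (𝓡 m) ∞
      (EuclideanSpace.basisFun (Fin m) ℝ).toBasis
    exact ⟨e.baseSet, e.open_baseSet, mem_baseSet_trivializationAt' p, _, h.contMDiffOn,
      fun x hx => ⟨h.linearIndependent hx, top_le_iff.1 (h.generating hx)⟩⟩

/-- The derivative is the fibre component of the tangent map of `f` composed with `X`. -/
lemma SmoothFieldOn.mvfderiv {E' : Type*} [NormedAddCommGroup E'] [NormedSpace ℝ E']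
    {X : ∀ x : M, TangentSpace (𝓡 m) x} {f : M → E'} {U : Set M}
    (hU : IsOpen U) (hf : ContMDiffOn (𝓡 m) 𝓘(ℝ, E') ∞ f U) (hX : SmoothFieldOn X U) :
    ContMDiffOn (𝓡 m) 𝓘(ℝ, E') ∞ (fun x => _root_.mvfderiv (𝓡 m) f x (X x)) U := by
  have : IsManifold (𝓡 m) 1 M := .of_le (n := ∞) (by norm_cast)
  have h := (hf.contMDiffOn_tangentMapWithin (m := ∞) (by simp) hU.uniqueMDiffOn).comp hX
    (fun x hx => hx)
  have h2 := (contMDiff_snd_tangentBundle_modelSpace (n := ∞) E' 𝓘(ℝ, E')).comp_contMDiffOn h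
  refine h2.congr fun x hx => ?_
  change _root_.mvfderiv (𝓡 m) f x (X x) = mfderivWithin (𝓡 m) 𝓘(ℝ, E') f U x (X x)
  rw [mfderivWithin_of_isOpen hU hx]
  rfl

lemma SmoothFieldOn.mlieBracket {X Y : ∀ x : M, TangentSpace (𝓡 m) x} {U : Set M}
    (hU : IsOpen U) (hX : SmoothFieldOn X U) (hY : SmoothFieldOn Y U) :
    SmoothFieldOn (VectorField.mlieBracket (𝓡 m) X Y) U := fun x hx =>
  haveI : IsManifold (𝓡 m) (minSmoothness ℝ 2) M := .of_le (n := ∞) (by simp; norm_cast)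
  haveI : IsManifold (𝓡 m) (((⊤ : ℕ∞) : WithTop ℕ∞) + 1) M := .of_le (n := ∞) (by simp)
  (ContMDiffAt.mlieBracket_vectorField (n := (⊤ : ℕ∞)) (m := (⊤ : ℕ∞))
    (hX.contMDiffAt (hU.mem_nhds hx)) (hY.contMDiffAt (hU.mem_nhds hx))
    (by simp)).contMDiffWithinAt

variable [RiemannianBundle (fun x : M => TangentSpace (𝓡 m) x)]
  [IsContMDiffRiemannianBundle (𝓡 m) ∞ (EuclideanSpace ℝ (Fin m))
    (fun x : M => TangentSpace (𝓡 m) x)]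

/-- The Koszul formula. -/
theorem IsLeviCivita.koszul {nab : CovariantDerivative (𝓡 m) (EuclideanSpace ℝ (Fin m))
    (fun x : M => TangentSpace (𝓡 m) x)} (h : IsLeviCivita nab)
    {X Y Z : ∀ x : M, TangentSpace (𝓡 m) x} {x : M}
    (hX : DiffFieldAt X x) (hY : DiffFieldAt Y x) (hZ : DiffFieldAt Z x) :
    2 * inner ℝ (nab Y x (X x)) (Z x) =
      mvfderiv (𝓡 m) (fun y => inner ℝ (Y y) (Z y)) x (X x) +
      mvfderiv (𝓡 m) (fun y => inner ℝ (X y) (Z y)) x (Y x) -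
      mvfderiv (𝓡 m) (fun y => inner ℝ (X y) (Y y)) x (Z x) +
      inner ℝ (mlieBracket (𝓡 m) X Y x) (Z x) - inner ℝ (mlieBracket (𝓡 m) X Z x) (Y x) -
      inner ℝ (mlieBracket (𝓡 m) Y Z x) (X x) := by
  have ht : ∀ {X Y : ∀ x : M, TangentSpace (𝓡 m) x}, DiffFieldAt X x → DiffFieldAt Y x →
      nab Y x (X x) - nab X x (Y x) = mlieBracket (𝓡 m) X Y x :=
    fun hX hY => nab.torsion_eq_zero_iff.1 h.2 hX hY
  rw [h.1.mvfderiv_inner_eq X hY hZ, h.1.mvfderiv_inner_eq Y hX hZ,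
    h.1.mvfderiv_inner_eq Z hX hY, ← ht hX hY, ← ht hX hZ, ← ht hY hZ]
  simp only [inner_sub_left, real_inner_comm]
  rw [real_inner_comm (nab Y x (X x)) (Z x), real_inner_comm (nab Y x (Z x)) (X x),
    real_inner_comm (nab Z x (X x)) (Y x), real_inner_comm (nab X x (Z x)) (Y x),
    real_inner_comm (nab X x (Y x)) (Z x), real_inner_comm (nab Z x (Y x)) (X x)]
  ring

/-- A Levi-Civita connection is smooth. -/
theorem IsLeviCivita.smoothFieldOn {nab : CovariantDerivative (𝓡 m) (EuclideanSpace ℝ (Fin m))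
    (fun x : M => TangentSpace (𝓡 m) x)} (h : IsLeviCivita nab)
    {X Y : ∀ x : M, TangentSpace (𝓡 m) x} {U : Set M} (hU : IsOpen U)
    (hX : SmoothFieldOn X U) (hY : SmoothFieldOn Y U) :
    SmoothFieldOn (fun x => nab Y x (X x)) U := by
  intro p hp
  -- Any local orthonormal frame of `TM` serves: the coefficients of `∇_X Y` in it are smooth by the
  -- Koszul formula.
  obtain ⟨F, W, hpW, hF⟩ := exists_isAdaptedFrame (fullDistribution m M) p
  have hO : IsOpen (U ∩ W) := hU.inter hF.isOpen
  have hX' : SmoothFieldOn X (U ∩ W) := hX.mono Set.inter_subset_left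
  have hY' : SmoothFieldOn Y (U ∩ W) := hY.mono Set.inter_subset_left
  have hF' : ∀ i, SmoothFieldOn (F i) (U ∩ W) := fun i => (hF.smooth i).mono Set.inter_subset_right
  have key : ∀ i, ContMDiffOn (𝓡 m) 𝓘(ℝ) ∞
      (fun x => inner ℝ (F i x) (nab Y x (X x))) (U ∩ W) := by
    intro i
    have h1 := (((((SmoothFieldOn.mvfderiv hO (hY'.contMDiffOn_inner (hF' i)) hX').add
      (SmoothFieldOn.mvfderiv hO (hX'.contMDiffOn_inner (hF' i)) hY')).sub
      (SmoothFieldOn.mvfderiv hO (hX'.contMDiffOn_inner hY') (hF' i))).add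
      ((SmoothFieldOn.mlieBracket hO hX' hY').contMDiffOn_inner (hF' i))).sub
      ((SmoothFieldOn.mlieBracket hO hX' (hF' i)).contMDiffOn_inner hY')).sub
      ((SmoothFieldOn.mlieBracket hO hY' (hF' i)).contMDiffOn_inner hX')
    refine ((contMDiffOn_const (c := (1 / 2 : ℝ))).mul h1).congr fun x hx => ?_
    have h2 := h.koszul (hX'.diffFieldAt hO hx) (hY'.diffFieldAt hO hx)
      ((hF' i).diffFieldAt hO hx)
    rw [real_inner_comm]
    simp only [Pi.mul_apply, Pi.add_apply]
    linarith
  have hs : SmoothFieldOn (fun x => nab Y x (X x)) (U ∩ W) := by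
    refine (SmoothFieldOn.sum (s := Finset.univ) fun i _ =>
      SmoothFieldOn.smul (key i) (hF' i)).congr fun x hx => ?_
    congr 1
    exact (sum_inner_smul_eq (hF.orthonormal x hx.2) _).symm
  exact (hs.contMDiffAt (hO.mem_nhds ⟨hp, hpW⟩)).contMDiffWithinAt

theorem nabla_smoothFieldOn {X Y : ∀ x : M, TangentSpace (𝓡 m) x} {U : Set M} (hU : IsOpen U)
    (hX : SmoothFieldOn X U) (hY : SmoothFieldOn Y U) : SmoothFieldOn (nabla X Y) U :=
  (leviCivita_spec m M).smoothFieldOn hU hX hY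

end Smoothness

/-! ### Velocity and acceleration in an adapted frame; sections through given vectors -/

section Curves

variable {m n : ℕ} {M : Type*} [TopologicalSpace M] [ChartedSpace (EuclideanSpace ℝ (Fin m)) M]

lemma IsSmoothCurveOn.mdifferentiableAt {γ : ℝ → M} {J : Set ℝ} (h : IsSmoothCurveOn m γ J)
    {t : ℝ} (ht : t ∈ J) : MDifferentiableAt 𝓘(ℝ, ℝ) (𝓡 m) γ t :=
  (h.2.2.contMDiffAt (h.1.mem_nhds ht)).mdifferentiableAt (by simp)

variable [IsManifold (𝓡 m) ∞ M]

/-- The velocity is the tangent map of `γ` applied to the constant unit field on `ℝ`. -/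
lemma IsSmoothCurveOn.contMDiffOn_velocity {γ : ℝ → M} {J : Set ℝ} (h : IsSmoothCurveOn m γ J) :
    ContMDiffOn 𝓘(ℝ, ℝ) ((𝓡 m).prod 𝓘(ℝ, EuclideanSpace ℝ (Fin m))) ∞
      (fun t => TotalSpace.mk' (EuclideanSpace ℝ (Fin m))
        (E := fun x : M => TangentSpace (𝓡 m) x) (γ t) (velocity m γ t)) J := by
  have : IsManifold (𝓡 m) 1 M := .of_le (n := ∞) (by norm_cast)
  have h1 : ContMDiffOn 𝓘(ℝ, ℝ) (𝓘(ℝ, ℝ).prod 𝓘(ℝ, ℝ)) ∞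
      (fun t : ℝ => TotalSpace.mk' ℝ (E := fun x : ℝ => TangentSpace 𝓘(ℝ, ℝ) x) t (1 : ℝ)) J :=
    contMDiffOn_vectorSpace_iff_contDiffOn.2 contDiffOn_const
  have h2 := (h.2.2.contMDiffOn_tangentMapWithin (m := ∞) (by simp) h.1.uniqueMDiffOn).comp h1
    (fun x hx => hx)
  refine h2.congr fun t ht => ?_
  change _ = TotalSpace.mk' _ (γ t) (mfderivWithin 𝓘(ℝ, ℝ) (𝓡 m) γ J t (1 : ℝ))
  rw [mfderivWithin_of_isOpen h.1 ht]
  rfl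

/-- The covariant derivative of a vector field along a curve. -/
lemma covDerivAlong_comp (nab : CovariantDerivative (𝓡 m) (EuclideanSpace ℝ (Fin m))
    (fun x : M => TangentSpace (𝓡 m) x)) {γ : ℝ → M} {t : ℝ}
    (hγ : MDifferentiableAt 𝓘(ℝ, ℝ) (𝓡 m) γ t) {X : ∀ x : M, TangentSpace (𝓡 m) x}
    (hX : DiffFieldAt X (γ t)) :
    covDerivAlong nab γ (fun s => X (γ s)) t = nab X (γ t) (velocity m γ t) := by
  rw [covDerivAlong_eq_sum nab (ι := Unit) hγ (f := fun _ _ => 1) (f' := fun _ => 0)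
    (Y := fun _ => X) (fun _ => hasDerivAt_const _ _) (fun _ => hX) (by simp)]
  simp

variable [RiemannianBundle (fun x : M => TangentSpace (𝓡 m) x)]

lemma RegularDistribution.proj_eq_self {D : RegularDistribution m M n} {p : M}
    {v : TangentSpace (𝓡 m) p} (hv : v ∈ D.fiber p) : D.proj p v = v :=
  Submodule.starProjection_eq_self_iff.2 hv

lemma RegularDistribution.proj_mem (D : RegularDistribution m M n) (p : M)
    (v : TangentSpace (𝓡 m) p) : D.proj p v ∈ D.fiber p :=
  Submodule.starProjection_apply_mem _ _

variable {D : RegularDistribution m M n} {F : Fin m → ∀ x : M, TangentSpace (𝓡 m) x} {U : Set M}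

lemma IsAdaptedFrame.proj_eq_zero (hF : IsAdaptedFrame D F U) {x : M} (hx : x ∈ U)
    {v : TangentSpace (𝓡 m) x} (h : ∀ k : Fin m, k < n → inner ℝ (F k x) v = 0) :
    D.proj x v = 0 := by
  refine (Submodule.starProjection_apply_eq_zero_iff _).2 fun w hw => ?_
  rw [← sum_inner_smul_eq (hF.orthonormal x hx) w, sum_inner]
  refine Finset.sum_eq_zero fun i _ => ?_
  rw [real_inner_smul_left]
  by_cases hi : i.val < n
  · rw [h i hi, mul_zero]
  · rw [(hF.mem_iff x hx w).1 hw i (not_lt.1 hi), zero_mul]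

lemma IsAdaptedFrame.inner_sum (hF : IsAdaptedFrame D F U) {x : M} (hx : x ∈ U)
    (a : Fin m → ℝ) (k : Fin m) : inner ℝ (F k x) (∑ i, a i • F i x) = a k :=
  (hF.orthonormal x hx).inner_right_fintype a k

/-- The coefficients of the velocity of a curve in a frame. -/
def velocityCoeff (F : Fin m → ∀ x : M, TangentSpace (𝓡 m) x) (γ : ℝ → M) (i : Fin m) (t : ℝ) :
    ℝ :=
  inner ℝ (F i (γ t)) (velocity m γ t)

lemma IsAdaptedFrame.velocity_eq (hF : IsAdaptedFrame D F U) {γ : ℝ → M} {t : ℝ}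
    (hU : γ t ∈ U) : velocity m γ t = ∑ i, velocityCoeff F γ i t • F i (γ t) :=
  (sum_inner_smul_eq (hF.orthonormal _ hU) _).symm

variable [IsContMDiffRiemannianBundle (𝓡 m) ∞ (EuclideanSpace ℝ (Fin m))
    (fun x : M => TangentSpace (𝓡 m) x)]

lemma IsAdaptedFrame.contMDiffAt_velocityCoeff (hF : IsAdaptedFrame D F U) {γ : ℝ → M} {J : Set ℝ}
    (h : IsSmoothCurveOn m γ J) {t : ℝ} (ht : t ∈ J) (hU : γ t ∈ U) (i : Fin m) :
    ContMDiffAt 𝓘(ℝ, ℝ) 𝓘(ℝ, ℝ) ∞ (velocityCoeff F γ i) t := by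
  have h1 := h.contMDiffOn_velocity.contMDiffAt (h.1.mem_nhds ht)
  have h2 := ((hF.smooth i).contMDiffAt (hF.isOpen.mem_nhds hU)).comp t
    (h.2.2.contMDiffAt (h.1.mem_nhds ht))
  exact ContMDiffAt.inner_bundle (F := EuclideanSpace ℝ (Fin m))
    (E := fun x : M => TangentSpace (𝓡 m) x) (b := γ) h2 h1

lemma IsAdaptedFrame.hasDerivAt_velocityCoeff (hF : IsAdaptedFrame D F U) {γ : ℝ → M} {J : Set ℝ}
    (h : IsSmoothCurveOn m γ J) {t : ℝ} (ht : t ∈ J) (hU : γ t ∈ U) (i : Fin m) :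
    HasDerivAt (velocityCoeff F γ i) (deriv (velocityCoeff F γ i) t) t :=
  ((hF.contMDiffAt_velocityCoeff h ht hU i).contDiffAt.differentiableAt (by simp)).hasDerivAt

/-- The acceleration of a curve in a frame. -/
lemma IsAdaptedFrame.acceleration_eq (hF : IsAdaptedFrame D F U) {γ : ℝ → M} {J : Set ℝ}
    (h : IsSmoothCurveOn m γ J) {t : ℝ} (ht : t ∈ J) (hU : γ t ∈ U) :
    acceleration m γ t = ∑ i, (deriv (velocityCoeff F γ i) t • F i (γ t) +
      velocityCoeff F γ i t • leviCivita m M (F i) (γ t) (velocity m γ t)) := by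
  refine covDerivAlong_eq_sum _ (h.mdifferentiableAt ht)
    (fun i => hF.hasDerivAt_velocityCoeff h ht hU i)
    (fun i => (hF.smooth i).diffFieldAt hF.isOpen hU) ?_
  filter_upwards [(h.mdifferentiableAt ht).continuousAt (hF.isOpen.mem_nhds hU)] with s hs
  exact hF.velocity_eq hs

/-- For a curve tangent to `D` and a section `X` of `D` extending its velocity at time `t`, the
acceleration agrees with `∇_X X` modulo `D`. -/
theorem acceleration_sub_nabla_mem {γ : ℝ → M} {J : Set ℝ} (h : IsSmoothCurveOn m γ J)
    (hD : ∀ t ∈ J, velocity m γ t ∈ D.fiber (γ t)) {t : ℝ} (ht : t ∈ J)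
    {X : ∀ x : M, TangentSpace (𝓡 m) x} (hX : X ∈ D.sections) (hXt : X (γ t) = velocity m γ t) :
    acceleration m γ t - nabla X X (γ t) ∈ D.fiber (γ t) := by
  obtain ⟨F, U, hU, hF⟩ := exists_isAdaptedFrame D (γ t)
  have hγ := h.mdifferentiableAt ht
  have hXs : SmoothFieldOn X U := hX.1.contMDiffOn
  set g : Fin m → ℝ → ℝ := fun i s => inner ℝ (F i (γ s)) (X (γ s)) with hg
  have hgd : ∀ i, HasDerivAt (g i) (deriv (g i) t) t := by
    intro i
    have h1 := (((hF.smooth i).contMDiffOn_inner hXs).contMDiffAt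
      (hF.isOpen.mem_nhds hU)).comp t (h.2.2.contMDiffAt (h.1.mem_nhds ht))
    exact (h1.contDiffAt.differentiableAt (by simp)).hasDerivAt
  have h2 : nabla X X (γ t) = ∑ i, (deriv (g i) t • F i (γ t) +
      g i t • leviCivita m M (F i) (γ t) (velocity m γ t)) := by
    rw [nabla, hXt, ← covDerivAlong_comp _ hγ (hXs.diffFieldAt hF.isOpen hU)]
    refine covDerivAlong_eq_sum _ hγ hgd
      (fun i => (hF.smooth i).diffFieldAt hF.isOpen hU) ?_
    filter_upwards [hγ.continuousAt (hF.isOpen.mem_nhds hU)] with s hs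
    exact (sum_inner_smul_eq (hF.orthonormal _ hs) _).symm
  have h3 : ∀ i, g i t = velocityCoeff F γ i t := fun i => by
    simp only [hg, hXt, velocityCoeff]
  -- The connection terms depend only on the coefficients at time `t`, where `X` and the velocity
  -- agree, so they cancel.
  have h4 : acceleration m γ t - nabla X X (γ t) =
      ∑ i, (deriv (velocityCoeff F γ i) t - deriv (g i) t) • F i (γ t) := by
    rw [hF.acceleration_eq h ht hU, h2, ← Finset.sum_sub_distrib]
    refine Finset.sum_congr rfl fun i _ => ?_
    rw [h3, sub_smul]
    abel
  rw [hF.mem_iff _ hU]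
  intro k hk
  rw [h4, hF.inner_sum hU, sub_eq_zero]
  -- Both normal coefficients vanish identically near `t`: one because `γ` is tangent to `D`, the
  -- other because `X` is a section of `D`.
  refine Filter.EventuallyEq.deriv_eq ?_
  filter_upwards [hγ.continuousAt (hF.isOpen.mem_nhds hU), h.1.mem_nhds ht] with s hs hsJ
  rw [velocityCoeff, (hF.mem_iff _ hs _).1 (hD s hsJ) k hk]
  exact ((hF.mem_iff _ hs _).1 (hX.2 _) k hk).symm

/-- Every vector of `D` extends to a section of `D`. -/
theorem RegularDistribution.exists_section [T2Space M] (D : RegularDistribution m M n) {p : M}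
    {v : TangentSpace (𝓡 m) p} (hv : v ∈ D.fiber p) : ∃ X ∈ D.sections, X p = v := by
  obtain ⟨F, U, hU, hF⟩ := exists_isAdaptedFrame D p
  obtain ⟨f, -, hf⟩ := (SmoothBumpFunction.nhds_basis_tsupport (I := 𝓡 m) p).mem_iff.1
    (hF.isOpen.mem_nhds hU)
  -- Constant coefficients in the adapted frame keep `Z` in `D` over `U`; the bump function makes it
  -- global.
  let Z : ∀ x : M, TangentSpace (𝓡 m) x := fun x => ∑ i, (inner ℝ (F i p) v : ℝ) • F i x
  have hZ : SmoothFieldOn Z U :=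
    SmoothFieldOn.sum fun i _ => SmoothFieldOn.smul contMDiffOn_const (hF.smooth i)
  refine ⟨fun x => f x • Z x, ⟨ContMDiffOn.smul_section_of_tsupport f.contMDiff.contMDiffOn
    hF.isOpen hf hZ, fun x => ?_⟩, ?_⟩
  · change f x • Z x ∈ D.fiber x
    by_cases hx : x ∈ U
    · refine Submodule.smul_mem _ _ ((hF.mem_iff x hx _).2 fun k hk => ?_)
      rw [hF.inner_sum hx]
      exact (hF.mem_iff p hU v).1 hv k hk
    · rw [image_eq_zero_of_notMem_tsupport fun h => hx (hf h), zero_smul]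
      exact Submodule.zero_mem _
  · change f p • Z p = v
    rw [f.eq_one, one_smul]
    exact sum_inner_smul_eq (hF.orthonormal p hU) v

end Curves

/-! ### Smooth ODE solutions and existence of geodesics -/

/-- Local existence of smooth solutions of an autonomous ODE with smooth right-hand side. -/
theorem exists_smooth_integralCurve {E : Type*} [NormedAddCommGroup E] [NormedSpace ℝ E]
    [CompleteSpace E] {f : E → E} {Ω : Set E} (hΩ : IsOpen Ω) (hf : ContDiffOn ℝ ∞ f Ω) {x₀ : E}
    (hx₀ : x₀ ∈ Ω) : ∃ α : ℝ → E, α 0 = x₀ ∧ ∃ ε > (0 : ℝ), ContDiffOn ℝ ∞ α (Set.Ioo (-ε) ε) ∧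
      ∀ t ∈ Set.Ioo (-ε) ε, α t ∈ Ω ∧ HasDerivAt α (f (α t)) t := by
  obtain ⟨α, h0, ε, hε, hα⟩ :=
    ContDiffAt.exists_forall_mem_closedBall_exists_eq_forall_mem_Ioo_hasDerivAt₀
      ((hf.contDiffAt (hΩ.mem_nhds hx₀)).of_le (by simp)) (0 : ℝ)
  have hc : ContinuousAt α 0 := (hα 0 ⟨by linarith, by linarith⟩).continuousAt
  obtain ⟨δ, hδ, hδΩ⟩ := Metric.mem_nhds_iff.1
    (hc.preimage_mem_nhds (h0 ▸ hΩ.mem_nhds hx₀))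
  -- Halving puts the closed interval `[-r, r]`, on which the regularity theorem is applied, inside
  -- both open intervals.
  set r := min (ε / 2) (δ / 2)
  have hr : 0 < r := lt_min (by linarith) (by linarith)
  have h1 : ∀ t ∈ Set.Icc (-r) r, α t ∈ Ω ∧ HasDerivAt α (f (α t)) t := by
    intro t ht
    have h2 : r ≤ ε / 2 := min_le_left _ _
    have h3 : r ≤ δ / 2 := min_le_right _ _
    refine ⟨hδΩ ?_, hα t ⟨by linarith [ht.1], by linarith [ht.2]⟩⟩
    rw [Real.ball_eq_Ioo]
    exact ⟨by linarith [ht.1], by linarith [ht.2]⟩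
  refine ⟨α, h0, r, hr, ?_, fun t ht => h1 t (Set.Ioo_subset_Icc_self ht)⟩
  refine ContDiffOn.mono ?_ Set.Ioo_subset_Icc_self
  refine ODE.contDiffOn_enat_Icc_of_hasDerivWithinAt (n := ⊤) (f := fun _ => f) (u := Ω) ?_
    (fun t ht => (h1 t ht).2.hasDerivWithinAt) fun t ht => (h1 t ht).1
  exact hf.comp contDiffOn_snd fun x hx => hx.2

section Existence

variable {m n : ℕ} {M : Type*} [TopologicalSpace M] [ChartedSpace (EuclideanSpace ℝ (Fin m)) M]
  [IsManifold (𝓡 m) ∞ M] [RiemannianBundle (fun x : M => TangentSpace (𝓡 m) x)]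
  [IsContMDiffRiemannianBundle (𝓡 m) ∞ (EuclideanSpace ℝ (Fin m))
    (fun x : M => TangentSpace (𝓡 m) x)]

/-- The Christoffel symbols of the Levi-Civita connection in an orthonormal frame. -/
def frameSymbol (F : Fin m → ∀ x : M, TangentSpace (𝓡 m) x) (i j k : Fin m) (x : M) : ℝ :=
  inner ℝ (F k x) (leviCivita m M (F i) x (F j x))

variable {D : RegularDistribution m M n} {F : Fin m → ∀ x : M, TangentSpace (𝓡 m) x} {U : Set M}

lemma IsAdaptedFrame.contMDiffOn_frameSymbol (hF : IsAdaptedFrame D F U) (i j k : Fin m) :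
    ContMDiffOn (𝓡 m) 𝓘(ℝ, ℝ) ∞ (frameSymbol F i j k) U :=
  (hF.smooth k).contMDiffOn_inner (nabla_smoothFieldOn hF.isOpen (hF.smooth j) (hF.smooth i))

/-- Existence of `∇^D`-geodesics with prescribed initial velocity in `D`. -/
theorem RegularDistribution.exists_geodesic (D : RegularDistribution m M n) {p : M}
    {X : ∀ x : M, TangentSpace (𝓡 m) x} (hX : X p ∈ D.fiber p) :
    ∃ (γ : ℝ → M) (J : Set ℝ), D.IsGeodesicOn γ J ∧ (0 : ℝ) ∈ J ∧ γ 0 = p ∧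
      X (γ 0) = velocity m γ 0 := by
  obtain ⟨F, U, hU, hF⟩ := exists_isAdaptedFrame D p
  set E := EuclideanSpace ℝ (Fin m) with hE
  set φ := extChartAt (𝓡 m) p with hφ
  set O : Set E := φ.target ∩ φ.symm ⁻¹' U with hOdef
  have hsymm : ContMDiffOn 𝓘(ℝ, E) (𝓡 m) ∞ φ.symm φ.target := contMDiffOn_extChartAt_symm p
  have hO : IsOpen O :=
    hsymm.continuousOn.isOpen_inter_preimage (isOpen_extChartAt_target p) hF.isOpen
  have hW : IsOpen (U ∩ φ.source) := hF.isOpen.inter (isOpen_extChartAt_source p)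
  have hOW : Set.MapsTo φ.symm O (U ∩ φ.source) := fun z hz => ⟨hz.2, φ.map_target hz.1⟩
  have hsymmO : ContMDiffOn 𝓘(ℝ, E) (𝓡 m) ∞ φ.symm O := hsymm.mono Set.inter_subset_left
  -- The cutoff `c` keeps only the coefficients tangential to `D`. Components of the unknown with
  -- index at least `n` are carried along without influencing the curve.
  let c : Fin m → ℝ := fun i => if i.val < n then 1 else 0
  let Fh : Fin m → E → E := fun i z => mvfderiv (𝓡 m) φ (φ.symm z) (F i (φ.symm z))
  let Gh : Fin m → Fin m → Fin m → E → ℝ := fun i j k z => frameSymbol F i j k (φ.symm z)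
  have hFh : ∀ i, ContDiffOn ℝ ∞ (Fh i) O := fun i =>
    ((SmoothFieldOn.mvfderiv hW ((contMDiffOn_extChartAt (x := p)).mono
      (by rw [← extChartAt_source (𝓡 m)]; exact Set.inter_subset_right))
      ((hF.smooth i).mono Set.inter_subset_left)).comp hsymmO hOW).contDiffOn
  have hGh : ∀ i j k, ContDiffOn ℝ ∞ (Gh i j k) O := fun i j k =>
    (((hF.contMDiffOn_frameSymbol i j k).mono Set.inter_subset_left).comp hsymmO hOW).contDiffOn
  -- The `∇^D`-geodesic equation as a first-order system for position in the chart and frame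
  -- coefficients of the velocity.
  let f : E × (Fin m → ℝ) → E × (Fin m → ℝ) := fun y =>
    (∑ i, (c i * y.2 i) • Fh i y.1,
      fun k => -∑ i, ∑ j, (c i * y.2 i) * (c j * y.2 j) * Gh i j k y.1)
  have hf : ContDiffOn ℝ ∞ f (O ×ˢ Set.univ) := by
    have hu : ∀ i, ContDiffOn ℝ ∞ (fun y : E × (Fin m → ℝ) => c i * y.2 i) (O ×ˢ Set.univ) :=
      fun i => by fun_prop
    have hfst : Set.MapsTo (Prod.fst : E × (Fin m → ℝ) → E) (O ×ˢ Set.univ) O := fun y hy => hy.1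
    refine ContDiffOn.prodMk (ContDiffOn.sum fun i _ => (hu i).smul
      ((hFh i).comp contDiffOn_fst hfst)) (contDiffOn_pi.2 fun k => (ContDiffOn.sum fun i _ =>
      ContDiffOn.sum fun j _ => ((hu i).mul (hu j)).mul
        ((hGh i j k).comp contDiffOn_fst hfst)).neg)
  have hp : φ p ∈ O := ⟨mem_extChartAt_target p, by
    rw [Set.mem_preimage, hφ, extChartAt_to_inv]; exact hU⟩
  obtain ⟨α, h0, ε, hε, hα, hder⟩ := exists_smooth_integralCurve
    (hO.prod isOpen_univ) hf (x₀ := (φ p, fun i => inner ℝ (F i p) (X p))) ⟨hp, trivial⟩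
  let γ : ℝ → M := fun t => φ.symm (α t).1
  let u : Fin m → ℝ → ℝ := fun i t => c i * (α t).2 i
  set J := Set.Ioo (-ε) ε with hJ
  have h0J : (0 : ℝ) ∈ J := ⟨by linarith, hε⟩
  have hγU : ∀ t ∈ J, γ t ∈ U := fun t ht => (hder t ht).1.1.2
  have hγ : IsSmoothCurveOn m γ J :=
    ⟨isOpen_Ioo, Set.ordConnected_Ioo, hsymmO.comp (hα.fst.contMDiffOn) fun t ht => (hder t ht).1.1⟩
  have hvel : ∀ t ∈ J, velocity m γ t = ∑ i, u i t • F i (γ t) := by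
    intro t ht
    have hz : HasDerivAt (fun t => (α t).1) (∑ i, u i t • Fh i (α t).1) t := (hder t ht).2.fst
    have ht' : (α t).1 ∈ φ.target := (hder t ht).1.1.1
    have hd : MDifferentiableAt 𝓘(ℝ, E) (𝓡 m) φ.symm (α t).1 :=
      (hsymmO.contMDiffAt (hO.mem_nhds (hder t ht).1.1)).mdifferentiableAt (by simp)
    let L : E →L[ℝ] TangentSpace (𝓡 m) (γ t) := mfderiv 𝓘(ℝ, E) (𝓡 m) φ.symm (α t).1
    have h1 : velocity m γ t = L (∑ i, u i t • Fh i (α t).1) := by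
      have h2 := hd.hasMFDerivAt.comp t hz.hasFDerivAt.hasMFDerivAt
      refine (congrArg (fun L => L (1 : ℝ)) h2.mfderiv).trans ?_
      change L (ContinuousLinearMap.toSpanSingleton ℝ (∑ i, u i t • Fh i (α t).1) 1) = _
      rw [ContinuousLinearMap.toSpanSingleton_apply, one_smul]
    -- The derivative of the inverse chart undoes the chart derivative built into `Fh`.
    have h4 := mfderivWithin_extChartAt_symm_comp_mfderiv_extChartAt (I := 𝓡 m) ht'
    rw [ModelWithCorners.range_eq_univ, mfderivWithin_univ] at h4
    have h5 : ∀ i, L (Fh i (α t).1) = F i (γ t) := fun i =>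
      congrArg (fun L => L (F i (φ.symm (α t).1))) h4
    rw [h1, map_sum]
    refine Finset.sum_congr rfl fun i _ => ?_
    rw [map_smul, h5]
  have hudiff : ∀ t ∈ J, ∀ i, HasDerivAt (u i)
      (c i * -∑ j, ∑ k, u j t * u k t * frameSymbol F j k i (γ t)) t := by
    intro t ht i
    exact (hasDerivAt_pi.1 (hder t ht).2.snd i).const_mul (c i)
  have hγ0 : γ 0 = p := by
    change φ.symm (α 0).1 = p
    rw [h0, hφ, extChartAt_to_inv]
  refine ⟨γ, J, ⟨hγ, fun t ht => ?_, fun t ht => ?_⟩, h0J, hγ0, ?_⟩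
  · rw [hF.mem_iff _ (hγU t ht)]
    intro k hk
    rw [hvel t ht, hF.inner_sum (hγU t ht)]
    simp only [u, c, not_lt.2 hk, if_false, zero_mul]
  -- Only components with `k < n` matter for the projection, and for these the ODE is exactly the
  -- vanishing of the acceleration component.
  · refine hF.proj_eq_zero (hγU t ht) fun k hk => ?_
    have hacc : acceleration m γ t = _ := covDerivAlong_eq_sum (leviCivita m M)
      (hγ.mdifferentiableAt ht) (hudiff t ht)
      (fun i => (hF.smooth i).diffFieldAt hF.isOpen (hγU t ht))
      (by filter_upwards [isOpen_Ioo.mem_nhds ht] with s hs using hvel s hs)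
    rw [hacc, Finset.sum_add_distrib, inner_add_right, hF.inner_sum (hγU t ht), inner_sum]
    have hck : c k = 1 := if_pos hk
    rw [hck, one_mul, neg_add_eq_zero]
    refine Finset.sum_congr rfl fun i _ => ?_
    rw [real_inner_smul_right, hvel t ht, map_sum, inner_sum, Finset.mul_sum]
    refine Finset.sum_congr rfl fun j _ => ?_
    rw [map_smul, real_inner_smul_right, frameSymbol, mul_assoc]
  -- The initial vector is the value of a field `X`, so that it can be compared with the velocity at
  -- `γ 0` without transport along `γ 0 = p`.
  · have hv0 : velocity m γ 0 = ∑ i, (c i * inner ℝ (F i p) (X p)) • F i (γ 0) := by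
      rw [hvel 0 h0J]
      simp only [u, h0]
    rw [hv0, hγ0]
    refine (sum_inner_smul_eq (hF.orthonormal p hU) (X p)).symm.trans
      (Finset.sum_congr rfl fun i _ => ?_)
    by_cases hi : i.val < n
    · simp only [c, hi, if_true, one_mul]
    · rw [(hF.mem_iff p hU _).1 hX i (not_lt.1 hi), mul_zero]

end Existence

/-! ### Uniqueness for linear systems -/

/-- A solution of a linear system of ODEs with continuous coefficients which vanishes at one time
vanishes near that time. -/
lemma eventually_eq_zero_of_linear_ode {ι : Type*} [Fintype ι] {w : ι → ℝ → ℝ}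
    {A : ι → ι → ℝ → ℝ} {t₀ : ℝ} (hA : ∀ k i, ContinuousAt (A k i) t₀)
    (hw : ∀ᶠ t in 𝓝 t₀, ∀ k, HasDerivAt (w k) (∑ i, A k i t * w i t) t)
    (h0 : ∀ k, w k t₀ = 0) : ∀ᶠ t in 𝓝 t₀, ∀ k, w k t = 0 := by
  let v : ℝ → (ι → ℝ) → ι → ℝ := fun t y k => ∑ i, A k i t * y i
  -- A crude Lipschitz constant for the sup norm, valid near `t₀`; the `+ 1` leaves room for the
  -- variation of the coefficients.
  set C : ℝ := ∑ k, ∑ i, (|A k i t₀| + 1) with hC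
  have hC0 : 0 ≤ C := by positivity
  have hb : ∀ᶠ t in 𝓝 t₀, ∀ k i, |A k i t| ≤ |A k i t₀| + 1 := by
    refine eventually_all.2 fun k => eventually_all.2 fun i => ?_
    exact (hA k i).abs.eventually_le_const (lt_add_one _)
  have hlip : ∀ᶠ t in 𝓝 t₀, LipschitzOnWith C.toNNReal (v t) Set.univ := by
    filter_upwards [hb] with t ht
    refine LipschitzOnWith.of_dist_le_mul fun x _ y _ => ?_
    rw [Real.coe_toNNReal _ hC0]
    refine (dist_pi_le_iff (by positivity)).2 fun k => ?_
    rw [Real.dist_eq, ← Finset.sum_sub_distrib]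
    calc |∑ i, (A k i t * x i - A k i t * y i)|
        ≤ ∑ i, |A k i t * x i - A k i t * y i| := Finset.abs_sum_le_sum_abs _ _
      _ ≤ ∑ i, (|A k i t₀| + 1) * dist x y := by
          refine Finset.sum_le_sum fun i _ => ?_
          rw [← mul_sub, abs_mul]
          exact mul_le_mul (ht k i) (dist_le_pi_dist x y i) (abs_nonneg _) (by positivity)
      _ = (∑ i, (|A k i t₀| + 1)) * dist x y := by rw [Finset.sum_mul]
      _ ≤ C * dist x y := by
          refine mul_le_mul_of_nonneg_right ?_ dist_nonneg
          exact Finset.single_le_sum (f := fun k => ∑ i, (|A k i t₀| + 1))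
            (fun k _ => by positivity) (Finset.mem_univ k)
  have h := ODE_solution_unique_of_eventually (v := v) (s := fun _ => Set.univ)
    (f := fun t k => w k t) (g := fun _ _ => 0) hlip
    (hw.mono fun t ht => ⟨hasDerivAt_pi.2 ht, trivial⟩)
    (Eventually.of_forall fun t => ⟨by simpa [v, Pi.zero_def] using hasDerivAt_const t (0 : ι → ℝ),
      trivial⟩)
    (funext h0)
  exact h.mono fun t ht k => congrFun ht k

/-! ### The implications between the conditions -/

section Main

variable {m n : ℕ} {M : Type*} [TopologicalSpace M] [ChartedSpace (EuclideanSpace ℝ (Fin m)) M]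
  [IsManifold (𝓡 m) ∞ M] [RiemannianBundle (fun x : M => TangentSpace (𝓡 m) x)]
  [IsContMDiffRiemannianBundle (𝓡 m) ∞ (EuclideanSpace ℝ (Fin m))
    (fun x : M => TangentSpace (𝓡 m) x)]
variable {D : RegularDistribution m M n} {F : Fin m → ∀ x : M, TangentSpace (𝓡 m) x} {U : Set M}

/-- The components of the acceleration of a curve in an adapted frame. -/
lemma IsAdaptedFrame.inner_acceleration (hF : IsAdaptedFrame D F U) {γ : ℝ → M} {J : Set ℝ}
    (h : IsSmoothCurveOn m γ J) {t : ℝ} (ht : t ∈ J) (hU : γ t ∈ U) (k : Fin m) :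
    inner ℝ (F k (γ t)) (acceleration m γ t) = deriv (velocityCoeff F γ k) t +
      ∑ i, ∑ j, velocityCoeff F γ i t * velocityCoeff F γ j t * frameSymbol F i j k (γ t) := by
  rw [hF.acceleration_eq h ht hU, Finset.sum_add_distrib, inner_add_right, hF.inner_sum hU,
    _root_.inner_sum]
  congr 1
  refine Finset.sum_congr rfl fun i _ => ?_
  rw [real_inner_smul_right]
  conv_lhs => rw [hF.velocity_eq hU, map_sum, _root_.inner_sum, Finset.mul_sum]
  refine Finset.sum_congr rfl fun j _ => ?_
  rw [map_smul, real_inner_smul_right, frameSymbol, mul_assoc]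

/-- Extend the velocity at time `t` to a section and compare by `acceleration_sub_nabla_mem`. -/
theorem acceleration_mem_of_nabla_self_mem [T2Space M]
    (h5 : ∀ X ∈ D.sections, nabla X X ∈ D.sections) {γ : ℝ → M} {J : Set ℝ}
    (h : IsSmoothCurveOn m γ J) (hD : ∀ t ∈ J, velocity m γ t ∈ D.fiber (γ t)) {t : ℝ}
    (ht : t ∈ J) : acceleration m γ t ∈ D.fiber (γ t) := by
  obtain ⟨X, hX, hXt⟩ := D.exists_section (hD t ht)
  have h1 := acceleration_sub_nabla_mem h hD ht hX hXt
  have h2 := Submodule.add_mem _ h1 ((h5 X hX).2 (γ t))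
  rwa [sub_add_cancel] at h2

/-- In an adapted frame, `∇_X X ∈ D` for sections `X` of `D` says that the symmetrised Christoffel
symbols with two indices in `D` and one index normal to `D` vanish. -/
lemma IsAdaptedFrame.sum_frameSymbol_eq_zero [T2Space M] (hF : IsAdaptedFrame D F U)
    (h5 : ∀ X ∈ D.sections, nabla X X ∈ D.sections) {x : M} (hx : x ∈ U) {a : Fin m → ℝ}
    (ha : ∀ i : Fin m, n ≤ i → a i = 0) {k : Fin m} (hk : n ≤ k) :
    ∑ i, ∑ j, a i * a j * frameSymbol F i j k x = 0 := by
  have hv : ∑ i, a i • F i x ∈ D.fiber x := by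
    rw [hF.mem_iff x hx]
    intro k hk
    rw [hF.inner_sum hx, ha k hk]
  obtain ⟨X, hX, hXx⟩ := D.exists_section hv
  -- Only a curve tangent to `D` with initial velocity `∑ a_i F_i` is needed; its geodesic equation
  -- is discarded. Along it the `k`-th velocity coefficient vanishes identically, so the `k`-th
  -- acceleration component at time `0` is the quadratic sum alone.
  obtain ⟨γ, J, ⟨hγ, hD, -⟩, h0, rfl, hXv⟩ := D.exists_geodesic (hX.2 x)
  have hu : ∀ i, velocityCoeff F γ i 0 = a i := fun i => by
    rw [velocityCoeff, ← hXv, hXx, hF.inner_sum hx]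
  have hd : deriv (velocityCoeff F γ k) 0 = 0 := by
    have : velocityCoeff F γ k =ᶠ[𝓝 0] fun _ => 0 := by
      filter_upwards [(hγ.mdifferentiableAt h0).continuousAt (hF.isOpen.mem_nhds hx),
        hγ.1.mem_nhds h0] with s hs hsJ
      exact (hF.mem_iff _ hs _).1 (hD s hsJ) k hk
    rw [this.deriv_eq, deriv_const]
  have h1 := hF.inner_acceleration hγ h0 hx k
  rw [(hF.mem_iff _ hx _).1 (acceleration_mem_of_nabla_self_mem h5 hγ hD h0) k hk, hd,
    zero_add] at h1
  simpa only [hu] using h1.symm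

/-- If `∇_X X ∈ D` for all sections `X` of `D`, a geodesic which is tangent to `D` at one time is
tangent to `D` nearby. -/
lemma eventually_velocity_mem [T2Space M] (h5 : ∀ X ∈ D.sections, nabla X X ∈ D.sections)
    {γ : ℝ → M} {J : Set ℝ} (h : IsGeodesicOn m γ J) {t₀ : ℝ} (ht₀ : t₀ ∈ J)
    (h0 : velocity m γ t₀ ∈ D.fiber (γ t₀)) :
    ∀ᶠ t in 𝓝 t₀, velocity m γ t ∈ D.fiber (γ t) := by
  obtain ⟨F, U, hU, hF⟩ := exists_isAdaptedFrame D (γ t₀)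
  have hγc : ContinuousAt γ t₀ := (h.1.mdifferentiableAt ht₀).continuousAt
  have hUJ : ∀ᶠ t in 𝓝 t₀, γ t ∈ U ∧ t ∈ J :=
    (hγc.eventually (hF.isOpen.mem_nhds hU)).and (h.1.1.mem_nhds ht₀)
  let u : Fin m → ℝ → ℝ := velocityCoeff F γ
  let a : Fin m → ℝ → ℝ := fun i t => if n ≤ i.val then 0 else u i t
  let w : Fin m → ℝ → ℝ := fun i t => if n ≤ i.val then u i t else 0
  let G : Fin m → Fin m → Fin m → ℝ → ℝ := fun i j k t => frameSymbol F i j k (γ t)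
  -- From `u_i u_j = a_i a_j + w_i u_j + a_i w_j`: once the `a_i a_j` terms are gone, the rest is
  -- linear in `w`, with `u` and `a` treated as known functions of time. Rows with `k < n` are zero,
  -- as `w k` is.
  let A : Fin m → Fin m → ℝ → ℝ := fun k i t =>
    if n ≤ k.val then -(∑ j, (u j t * G i j k t + a j t * G j i k t)) else 0
  have hu : ∀ i, ContinuousAt (u i) t₀ := fun i =>
    (hF.contMDiffAt_velocityCoeff h.1 ht₀ hU i).continuousAt
  have ha : ∀ i, ContinuousAt (a i) t₀ := fun i => by
    by_cases hi : n ≤ i.val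
    · simpa only [a, if_pos hi] using continuousAt_const
    · simpa only [a, if_neg hi] using hu i
  have hG : ∀ i j k, ContinuousAt (G i j k) t₀ := fun i j k =>
    ((hF.contMDiffOn_frameSymbol i j k).continuousOn.continuousAt
      (hF.isOpen.mem_nhds hU)).comp hγc
  have hA : ∀ k i, ContinuousAt (A k i) t₀ := fun k i => by
    by_cases hk : n ≤ k.val
    · simp only [A, if_pos hk]
      exact (tendsto_finsetSum _ fun j _ =>
        ((hu j).mul (hG i j k)).add ((ha j).mul (hG j i k))).neg
    · simpa only [A, if_neg hk] using continuousAt_const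
  have hw : ∀ᶠ t in 𝓝 t₀, ∀ k, HasDerivAt (w k) (∑ i, A k i t * w i t) t := by
    filter_upwards [hUJ] with t ⟨htU, htJ⟩ k
    by_cases hk : n ≤ k.val
    · simp only [w, A, if_pos hk]
      refine (hF.hasDerivAt_velocityCoeff h.1 htJ htU k).congr_deriv ?_
      have h1 := hF.inner_acceleration h.1 htJ htU k
      rw [h.2 t htJ, inner_zero_right] at h1
      have h2 := hF.sum_frameSymbol_eq_zero h5 htU (a := fun i => a i t)
        (fun i hi => if_pos hi) hk
      have hsum : ∀ i, u i t = a i t + w i t := fun i => by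
        by_cases hi : n ≤ i.val <;> simp [a, w, hi]
      have h3 : ∑ i, ∑ j, u i t * u j t * G i j k t = ∑ i, ∑ j, a i t * a j t * G i j k t +
          ∑ i, (∑ j, (u j t * G i j k t + a j t * G j i k t)) * w i t := by
        -- Exchanging the summation indices collects the `a_i w_j` terms by the index of `w`.
        have h4 : ∑ i, (∑ j, a j t * G j i k t) * w i t =
            ∑ i, ∑ j, a i t * w j t * G i j k t := by
          rw [Finset.sum_comm]
          refine Finset.sum_congr rfl fun i _ => ?_
          rw [Finset.sum_mul]
          exact Finset.sum_congr rfl fun j _ => by ring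
        simp only [Finset.sum_add_distrib, add_mul]
        rw [h4, ← Finset.sum_add_distrib, ← Finset.sum_add_distrib]
        refine Finset.sum_congr rfl fun i _ => ?_
        rw [Finset.sum_mul, ← Finset.sum_add_distrib, ← Finset.sum_add_distrib]
        refine Finset.sum_congr rfl fun j _ => ?_
        rw [hsum i, hsum j]
        ring
      change ∑ i, ∑ j, a i t * a j t * G i j k t = 0 at h2
      change 0 = deriv (u k) t + ∑ i, ∑ j, u i t * u j t * G i j k t at h1
      rw [h3, h2, zero_add] at h1
      simp only [neg_mul, Finset.sum_neg_distrib]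
      exact eq_neg_of_add_eq_zero_left h1.symm
    · simpa only [w, A, if_neg hk, zero_mul, Finset.sum_const_zero] using hasDerivAt_const t (0 : ℝ)
  have hw0 : ∀ k, w k t₀ = 0 := fun k => by
    by_cases hk : n ≤ k.val
    · exact (if_pos hk).trans ((hF.mem_iff _ hU _).1 h0 k hk)
    · simp only [w, if_neg hk]
  filter_upwards [eventually_eq_zero_of_linear_ode hA hw hw0, hUJ] with t ht htU
  rw [hF.mem_iff _ htU.1]
  intro k hk
  exact (if_pos hk).symm.trans (ht k)

/-- The times at which a curve is not tangent to `D` form an open set. -/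
lemma eventually_velocity_notMem {γ : ℝ → M} {J : Set ℝ} (h : IsSmoothCurveOn m γ J) {t₀ : ℝ}
    (ht₀ : t₀ ∈ J) (h0 : velocity m γ t₀ ∉ D.fiber (γ t₀)) :
    ∀ᶠ t in 𝓝 t₀, velocity m γ t ∉ D.fiber (γ t) := by
  obtain ⟨F, U, hU, hF⟩ := exists_isAdaptedFrame D (γ t₀)
  rw [hF.mem_iff _ hU] at h0
  push Not at h0
  obtain ⟨k, hk, hk0⟩ := h0
  filter_upwards [(hF.contMDiffAt_velocityCoeff h ht₀ hU k).continuousAt.eventually_ne hk0,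
    (h.mdifferentiableAt ht₀).continuousAt (hF.isOpen.mem_nhds hU)] with t ht htU hmem
  exact ht ((hF.mem_iff _ htU _).1 hmem k hk)

/-- The tangent times and the non-tangent times are both open, and `J` is connected. -/
theorem isTotallyGeodesic_of_nabla_self_mem [T2Space M]
    (h5 : ∀ X ∈ D.sections, nabla X X ∈ D.sections) : D.IsTotallyGeodesic := by
  intro γ J h t₀ ht₀ h0
  have hJ : IsPreconnected J := h.1.2.1.isPreconnected
  have h1 : IsOpen {t | t ∈ J ∧ velocity m γ t ∈ D.fiber (γ t)} :=
    isOpen_iff_mem_nhds.2 fun t ht =>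
      (h.1.1.eventually_mem ht.1).and (eventually_velocity_mem h5 h ht.1 ht.2)
  have h2 : IsOpen {t | t ∈ J ∧ velocity m γ t ∉ D.fiber (γ t)} :=
    isOpen_iff_mem_nhds.2 fun t ht =>
      (h.1.1.eventually_mem ht.1).and (eventually_velocity_notMem h.1 ht.1 ht.2)
  exact fun t ht => (hJ.subset_left_of_subset_union h1 h2
    (Set.disjoint_left.2 fun t ht ht' => ht'.2 ht.2)
    (fun t ht => (em _).imp (And.intro ht) (And.intro ht)) ⟨t₀, ht₀, ht₀, h0⟩ ht).2

/-- The acceleration lies in `D`, so it equals its own projection, which vanishes. -/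
theorem RegularDistribution.IsGeodesicOn.isGeodesicOn [T2Space M]
    (h5 : ∀ X ∈ D.sections, DistGeom.nabla X X ∈ D.sections) {γ : ℝ → M} {J : Set ℝ}
    (h : D.IsGeodesicOn γ J) : DistGeom.IsGeodesicOn m γ J := by
  refine ⟨h.1, fun t ht => ?_⟩
  rw [← h.2.2 t ht]
  exact (proj_eq_self (acceleration_mem_of_nabla_self_mem h5 h.1 h.2.1 ht)).symm

lemma contMDiff_nabla {X Y : ∀ x : M, TangentSpace (𝓡 m) x} (hX : X ∈ D.sections)
    (hY : Y ∈ D.sections) : ContMDiff (𝓡 m) ((𝓡 m).prod 𝓘(ℝ, EuclideanSpace ℝ (Fin m))) ∞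
      (fun x => TotalSpace.mk' (EuclideanSpace ℝ (Fin m)) x (nabla X Y x)) :=
  contMDiffOn_univ.1 (nabla_smoothFieldOn isOpen_univ hX.1.contMDiffOn hY.1.contMDiffOn)

/-- `∇_X X` is a section of `D` as soon as through every vector of `D` there is a geodesic tangent
to `D`. -/
theorem nabla_self_mem {X : ∀ x : M, TangentSpace (𝓡 m) x} (hX : X ∈ D.sections)
    (h : ∀ p : M, ∃ (γ : ℝ → M) (J : Set ℝ), DistGeom.IsGeodesicOn m γ J ∧
      (∀ t ∈ J, velocity m γ t ∈ D.fiber (γ t)) ∧ (0 : ℝ) ∈ J ∧ γ 0 = p ∧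
      X (γ 0) = velocity m γ 0) : nabla X X ∈ D.sections := by
  refine ⟨contMDiff_nabla hX hX, fun p => ?_⟩
  obtain ⟨γ, J, hγ, hD, h0, rfl, hv⟩ := h p
  have := acceleration_sub_nabla_mem hγ.1 hD h0 hX hv
  rwa [hγ.2 0 h0, zero_sub, neg_mem_iff] at this

theorem nabla_self_mem_of_isTotallyGeodesic (hD : D.IsTotallyGeodesic)
    {X : ∀ x : M, TangentSpace (𝓡 m) x} (hX : X ∈ D.sections) : nabla X X ∈ D.sections := by
  refine nabla_self_mem hX fun p => ?_
  -- For `D = TM` the projection is the identity, so this is an ordinary geodesic.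
  obtain ⟨γ, J, hγ, h0, hp, hv⟩ := (fullDistribution m M).exists_geodesic (p := p) (X := X) trivial
  have hγ' : DistGeom.IsGeodesicOn m γ J :=
    ⟨hγ.1, fun t ht => ((fullDistribution m M).proj_eq_self trivial).symm.trans (hγ.2.2 t ht)⟩
  refine ⟨γ, J, hγ', hD γ J hγ' 0 h0 ?_, h0, hp, hv⟩
  rw [← hv]
  exact hX.2 _

/-- By linearity of the projection, `2 B^s(X, Y)` is the component of `∇_X Y + ∇_Y X` normal to `D`.
-/
theorem symmSecondFundamentalForm_eq_zero_iff {X Y : ∀ x : M, TangentSpace (𝓡 m) x} {p : M} :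
    D.symmSecondFundamentalForm X Y p = 0 ↔ nabla X Y p + nabla Y X p ∈ D.fiber p := by
  have h : D.secondFundamentalForm X Y p + D.secondFundamentalForm Y X p =
      (nabla X Y p + nabla Y X p) - D.proj p (nabla X Y p + nabla Y X p) := by
    simp only [RegularDistribution.secondFundamentalForm, RegularDistribution.nabla, map_add]
    abel
  rw [RegularDistribution.symmSecondFundamentalForm, h, smul_eq_zero_iff_right (by norm_num),
    sub_eq_zero]
  exact ⟨fun h => h ▸ D.proj_mem p _, fun h => (RegularDistribution.proj_eq_self h).symm⟩

theorem nabla_add_nabla_mem_sections {X Y : ∀ x : M, TangentSpace (𝓡 m) x}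
    (hX : X ∈ D.sections) (hY : Y ∈ D.sections)
    (h : ∀ p, nabla X Y p + nabla Y X p ∈ D.fiber p) :
    (fun p => nabla X Y p + nabla Y X p) ∈ D.sections :=
  ⟨(contMDiff_nabla hX hY).add_section (contMDiff_nabla hY hX), h⟩

theorem nabla_self_mem_of_nabla_add_nabla_mem {X : ∀ x : M, TangentSpace (𝓡 m) x}
    (hX : X ∈ D.sections) (h : (fun p => nabla X X p + nabla X X p) ∈ D.sections) :
    nabla X X ∈ D.sections := by
  refine ⟨contMDiff_nabla hX hX, fun p => ?_⟩
  have h1 : (2⁻¹ : ℝ) • (nabla X X p + nabla X X p) ∈ D.fiber p :=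
    (D.fiber p).smul_mem _ (h.2 p)
  rwa [← two_smul ℝ, inv_smul_smul₀ two_ne_zero] at h1

/-- Polarization: expand `∇_{X+Y} (X+Y)` and subtract the two diagonal terms. -/
theorem nabla_add_nabla_mem (h5 : ∀ X ∈ D.sections, nabla X X ∈ D.sections)
    {X Y : ∀ x : M, TangentSpace (𝓡 m) x} (hX : X ∈ D.sections) (hY : Y ∈ D.sections) (p : M) :
    nabla X Y p + nabla Y X p ∈ D.fiber p := by
  have hXY : X + Y ∈ D.sections :=
    ⟨hX.1.add_section hY.1, fun p => Submodule.add_mem _ (hX.2 p) (hY.2 p)⟩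
  have hadd : leviCivita m M (X + Y) p = leviCivita m M X p + leviCivita m M Y p :=
    (leviCivita m M).isCovariantDerivativeOnUniv.add
      ((hX.1 p).mdifferentiableAt (by simp)) ((hY.1 p).mdifferentiableAt (by simp))
  have h : nabla X Y p + nabla Y X p =
      nabla (X + Y) (X + Y) p - nabla X X p - nabla Y Y p := by
    simp only [nabla, hadd, Pi.add_apply, map_add, add_apply]
    abel
  rw [h]
  exact Submodule.sub_mem _ (Submodule.sub_mem _ ((h5 _ hXY).2 p) ((h5 X hX).2 p)) ((h5 Y hY).2 p)

end Main

end DistGeom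

end

theorem mainTheorem1 {m n : ℕ} {M : Type*} [TopologicalSpace M] [T2Space M]
    [ChartedSpace (EuclideanSpace ℝ (Fin m)) M] [IsManifold (𝓡 m) ∞ M]
    [RiemannianBundle (fun x : M => TangentSpace (𝓡 m) x)]
    [IsContMDiffRiemannianBundle (𝓡 m) ∞ (EuclideanSpace ℝ (Fin m))
      (fun x : M => TangentSpace (𝓡 m) x)]
    (D : DistGeom.RegularDistribution m M n) :
    List.TFAE [
      D.IsTotallyGeodesic,
      ∀ (γ : ℝ → M) (J : Set ℝ), D.IsGeodesicOn γ J → DistGeom.IsGeodesicOn m γ J,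
      ∀ X ∈ D.sections, ∀ Y ∈ D.sections, ∀ p, D.symmSecondFundamentalForm X Y p = 0,
      ∀ X ∈ D.sections, ∀ Y ∈ D.sections,
        (fun p => DistGeom.nabla X Y p + DistGeom.nabla Y X p) ∈ D.sections,
      ∀ X ∈ D.sections, DistGeom.nabla X X ∈ D.sections] := by
  tfae_have 1 → 5 := fun h X hX => DistGeom.nabla_self_mem_of_isTotallyGeodesic h hX
  tfae_have 2 → 5 := by
    intro h X hX
    refine DistGeom.nabla_self_mem hX fun p => ?_
    obtain ⟨γ, J, hγ, h0, hp, hv⟩ := D.exists_geodesic (hX.2 p)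
    exact ⟨γ, J, h γ J hγ, hγ.2.1, h0, hp, hv⟩
  tfae_have 5 → 2 := fun h γ J hγ => hγ.isGeodesicOn h
  tfae_have 5 → 1 := DistGeom.isTotallyGeodesic_of_nabla_self_mem
  tfae_have 3 → 4 := fun h X hX Y hY => DistGeom.nabla_add_nabla_mem_sections hX hY fun p =>
    DistGeom.symmSecondFundamentalForm_eq_zero_iff.1 (h X hX Y hY p)
  tfae_have 4 → 5 := fun h X hX => DistGeom.nabla_self_mem_of_nabla_add_nabla_mem hX (h X hX X hX)
  tfae_have 5 → 3 := fun h X hX Y hY p =>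
    DistGeom.symmSecondFundamentalForm_eq_zero_iff.2 (DistGeom.nabla_add_nabla_mem h hX hY p)
  tfae_finish
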